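/- **Setting.** Let $G$ be a connected, simply connected, simple algebraic group of rank $r$ over $\mathbb C$, with opposite Borel subgroups $B_\pm$, $H=B_+\cap B_-$, unipotent radicals $N_\pm\subset B_\pm$, Lie algebras $\mathfrak b_\pm,\mathfrak h,\mathfrak n_\pm\subset\mathfrak g$, Chevalley generators $e_i,f_i,\check\alpha_i$ ($1\le i\le r$), simple roots $\alpha_i$ and Cartan matrix $a_{ij}=\langle\alpha_j,\check\alpha_i\rangle$. Fix monic polynomials $\Lambda_1,\dots,\Lambda_r\in\mathbb C[z]$ and $Z^H=\sum_i\zeta_i\check\alpha_i\in\mathfrak h$; then $\langle\alpha_i,Z^H\rangle=\sum_j a_{ji}\zeta_j$. For a group or Lie algebra $X$ write $X(z)$ for its points over $\mathbb C(z)$. An element $g\in G(z)$ acts on connections by $g(\partial_z+A)g^{-1}=\partial_z+gAg^{-1}+g\,\partial_z(g^{-1})$. **Opers.** A Miura $G$-oper on $\mathbb P^1$ is a $G$-bundle with a meromorphic connection $\nabla$, a reduction to $B_-$ such that in a generic trivialization of this reduction $\nabla=\partial_z+\sum_i\phi_i e_i+b$ with $0\ne\phi_i\in\mathbb C(z)$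 and $b\in\mathfrak b_-(z)$, and a reduction to $B_+$ preserved by $\nabla$. Miura opers are identified when they are isomorphic over a dense open subset of $\mathbb P^1$. All of them are assumed to have regular singularities determined by the $\Lambda_i$: in some trivialization of the $B_-$-reduction, $\phi_i=\Lambda_i$ for all $i$. Let $W_i$ be the $B_+$-stable plane spanned by $\nu_i$ and $f_i\nu_i$ in the irreducible representation of $G$ whose highest weight is the $i$-th fundamental weight, $\nu_i$ being a highest weight vector. The Miura oper is *$Z^H$-twisted Miura–Plücker* if, $\nabla$ being written in a trivialization of the $B_+$-reduction, there is $v\in B_+(z)$ with $\nabla|_{W_i}=v(\partial_z+Z^H)v^{-1}|_{W_i}$ for all $i$. Call a tuple $(y_1,\dots,y_r)$ of nonzero rational functions *admissible for $(\Lambda_i)$* if (finite zeros and poles being meant) no $y_i$ has a multiple zero or pole; no root of $\Lambda_i$ is a zero or pole of $y_i$; and $y_i,y_j$ have no zero or pole in common when $i\ne j$ and $a_{ij}\ne0$. A $Z^H$-twisted Miura–Plücker oper is *nondegenerate* if, in a trivialization compatible with both reductions, $$\nabla=\partial_z+\sum_i g_i\check\alpha_i+\sum_i\Lambda_ie_i,\qquad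 g_i=\zeta_i-y_i'/y_i,$$ with $(y_i)$ admissible for $(\Lambda_i)$, and, for each $i$, the Miura $\mathrm{SL}(2)$-oper $\partial_z+g_i\check\alpha_i+\rho_ie_i$, $\rho_i=\Lambda_i\prod_{k\ne i}y_k^{-a_{ki}}$, is nondegenerate: $y_i$ and $\rho_i$ are polynomials, and $y_i$ is admissible for $\rho_i$. **The $qq$-system.** A nondegenerate polynomial solution consists of polynomials $q^i_+,q^i_-$ $(1\le i\le r)$ with all $q_+^i$ monic, $(q^i_+)$ admissible for $(\Lambda_i)$, and $$q_+^i\,\partial_zq_-^i-q_-^i\,\partial_zq_+^i+\langle\alpha_i,Z^H\rangle q_+^iq_-^i=\Lambda_i\prod_{j\ne i}(q_+^j)^{-a_{ji}},\qquad i=1,\dots,r.$$ **Bethe Ansatz equations.** A solution is a family of finite sets $\{w^i_\ell\}_\ell\subset\mathbb C$ $(1\le i\le r)$ such that no $w^i_\ell$ is a root of $\Lambda_i$, the $i$-th and $j$-th sets are disjoint when $i\ne j$ and $a_{ji}\ne0$, and, with $q_j(z)=\prod_s(z-w^j_s)$, for all $i,\ell$ $$\langle\alpha_i,Z^H\rangle+\partial_z\log\Big[\Lambda_i(z)\prod_jq_j(z)^{-a_{ji}}(z-w^i_\ell)^2\Big]\Big|_{z=w^i_\ell}=0.$$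 **Theorem 5.10.** Let $F$ send a nondegenerate polynomial solution of the $qq$-system to the Miura oper with connection $$\partial_z+\sum_i\Big(\zeta_i-\frac{\partial_zq_+^i}{q_+^i}\Big)\check\alpha_i+\sum_i\Lambda_ie_i$$ on the trivial bundle, with the standard reductions to $B_\pm$, and let $B$ send it to the family of the sets of roots of the $q_+^i$. Then $F$ is a well-defined surjection onto the set of nondegenerate $Z^H$-twisted Miura–Plücker $G$-opers, and $B$ is a well-defined surjection onto the set of solutions of the Bethe Ansatz equations. The fibres of each map consist of all the solutions with fixed $q_+^1,\dots,q_+^r$. Consequently there is a unique bijection $\Phi$ from the set of nondegenerate $Z^H$-twisted Miura–Plücker $G$-opers to the set of solutions of the Bethe Ansatz equations such that $\Phi\circ F=B$. -/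

import Mathlib

open scoped TensorProduct

noncomputable section

namespace MiuraPlucker

open Polynomial

/-! ### The differential field of rational functions -/

/-- The field `ℂ(z)` of rational functions on the projective line. -/
abbrev RatFn := RatFunc ℂ

/-- A polynomial, viewed as a rational function. -/
abbrev ofPoly (p : ℂ[X]) : RatFn := algebraMap ℂ[X] RatFn p

/-- The quotient rule applied to the reduced fraction of `f`. -/
def derivFun (f : RatFn) : RatFn :=
  (ofPoly (derivative f.num) * ofPoly f.denom - ofPoly f.num * ofPoly (derivative f.denom)) /
    ofPoly f.denom ^ 2

theorem derivFun_div (p q : ℂ[X]) (hq : q ≠ 0) :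
    derivFun (ofPoly p / ofPoly q) =
      (ofPoly (derivative p) * ofPoly q - ofPoly p * ofPoly (derivative q)) / ofPoly q ^ 2 := by
  set f : RatFn := ofPoly p / ofPoly q with hf
  have hd : f.denom ≠ 0 := f.denom_ne_zero
  have hq' : ofPoly q ≠ 0 := by simpa [ofPoly] using hq
  have hd' : ofPoly f.denom ≠ 0 := by simpa [ofPoly] using hd
  have h0 : ofPoly f.num / ofPoly f.denom = ofPoly p / ofPoly q := by
    rw [← hf]; exact RatFunc.num_div_denom f
  rw [div_eq_div_iff hd' hq'] at h0
  have h1 : f.num * q = p * f.denom := by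
    apply IsFractionRing.injective ℂ[X] RatFn
    simpa [ofPoly] using h0
  have h2 := congrArg derivative h1
  simp only [derivative_mul] at h2
  have h3 := congrArg (algebraMap ℂ[X] RatFn) h2
  simp only [map_add, map_mul] at h3
  rw [derivFun, div_eq_div_iff (pow_ne_zero 2 hd') (pow_ne_zero 2 hq')]
  simp only [ofPoly] at *
  linear_combination (algebraMap ℂ[X] RatFn f.denom * algebraMap ℂ[X] RatFn q) * h3 -
    (algebraMap ℂ[X] RatFn (derivative q) * algebraMap ℂ[X] RatFn f.denom +
      algebraMap ℂ[X] RatFn (derivative f.denom) * algebraMap ℂ[X] RatFn q) * h0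

theorem exists_frac (f : RatFn) : ∃ p q : ℂ[X], q ≠ 0 ∧ f = ofPoly p / ofPoly q :=
  ⟨f.num, f.denom, f.denom_ne_zero, (RatFunc.num_div_denom f).symm⟩

/-- The derivation `∂_z` of `ℂ(z)`. -/
def dz : Derivation ℂ RatFn RatFn :=
  Derivation.mk'
    { toFun := derivFun
      map_add' := by
        intro f g
        obtain ⟨p, q, hq, rfl⟩ := exists_frac f
        obtain ⟨r, s, hs, rfl⟩ := exists_frac g
        have hq' : ofPoly q ≠ 0 := by simpa [ofPoly] using hq
        have hs' : ofPoly s ≠ 0 := by simpa [ofPoly] using hs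
        have e : ofPoly p / ofPoly q + ofPoly r / ofPoly s
            = ofPoly (p * s + q * r) / ofPoly (q * s) := by
          simp only [ofPoly, map_add, map_mul] at *; field_simp
        rw [e, derivFun_div _ _ (mul_ne_zero hq hs), derivFun_div _ _ hq, derivFun_div _ _ hs]
        simp only [ofPoly, map_add, map_mul, derivative_mul] at *
        field_simp
        ring
      map_smul' := by
        intro c f
        obtain ⟨p, q, hq, rfl⟩ := exists_frac f
        have e : c • (ofPoly p / ofPoly q) = ofPoly (c • p) / ofPoly q := by
          simp [ofPoly, Algebra.smul_def, mul_div_assoc]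
        rw [e, derivFun_div _ _ hq, derivFun_div _ _ hq]
        simp [ofPoly, Algebra.smul_def]
        ring }
    (by
      intro f g
      obtain ⟨p, q, hq, rfl⟩ := exists_frac f
      obtain ⟨r, s, hs, rfl⟩ := exists_frac g
      have hq' : ofPoly q ≠ 0 := by simpa [ofPoly] using hq
      have hs' : ofPoly s ≠ 0 := by simpa [ofPoly] using hs
      have e : ofPoly p / ofPoly q * (ofPoly r / ofPoly s)
          = ofPoly (p * r) / ofPoly (q * s) := by
        simp only [ofPoly, map_mul] at *; field_simp
      simp only [LinearMap.coe_mk, AddHom.coe_mk, smul_eq_mul]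
      rw [e, derivFun_div _ _ (mul_ne_zero hq hs), derivFun_div _ _ hq, derivFun_div _ _ hs]
      simp only [ofPoly, map_add, map_mul, derivative_mul] at *
      field_simp
      ring)

theorem dz_ofPoly (p : ℂ[X]) : dz (ofPoly p) = ofPoly (derivative p) := by
  have h := derivFun_div p 1 one_ne_zero
  simp only [ofPoly, map_one, div_one, derivative_one, map_zero, mul_zero, sub_zero, mul_one,
    one_pow] at h
  exact h

/-- A point of `ℂ` is a zero of the rational function `f`. -/
def IsZeroOf (f : RatFn) (w : ℂ) : Prop := f.num.IsRoot w

/-- A point of `ℂ` is a pole of the rational function `f`. -/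
def IsPoleOf (f : RatFn) (w : ℂ) : Prop := f.denom.IsRoot w

/-- `w` is a zero or a pole of `f`. -/
def IsZeroOrPoleOf (f : RatFn) (w : ℂ) : Prop := IsZeroOf f w ∨ IsPoleOf f w

/-- The conditions on rational functions `y i` in the definition of `H`-nondegeneracy, for a
generalized Cartan matrix `a` and rational functions `L i`. -/
structure YNondegenerate {ι : Type*} (a : Matrix ι ι ℤ) (L y : ι → RatFn) : Prop where
  ne_zero : ∀ i, y i ≠ 0
  simple : ∀ i w, (y i).num.rootMultiplicity w ≤ 1 ∧ (y i).denom.rootMultiplicity w ≤ 1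
  disjoint_sing : ∀ i w, IsZeroOf (L i) w → ¬ IsZeroOrPoleOf (y i) w
  disjoint : ∀ i j w, i ≠ j → a i j ≠ 0 → IsZeroOrPoleOf (y i) w → ¬ IsZeroOrPoleOf (y j) w

/-- Nondegeneracy of the twisted Miura `SL(2)`-oper `∂_z + g(z) α̌ + ρ(z) e` with twist `ζ α̌`:
it has regular singularities (`ρ` is a polynomial), it is `H`-nondegenerate, and the rational
function `y` with `g = ζ - y'/y` is a polynomial. -/
def SL2Nondegenerate (ζ : ℂ) (ρ g : RatFn) : Prop :=
  (∃ p : ℂ[X], ρ = ofPoly p) ∧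
  ∃ y : RatFn, g = ofPoly (C ζ) - dz y / y ∧
    YNondegenerate (fun _ _ : Unit => (2 : ℤ)) (fun _ => ρ) (fun _ => y) ∧
    ∃ p : ℂ[X], y = ofPoly p

/-! ### The group `G` and its subgroups over `ℂ(z)` -/

section Group

variable {ι : Type*} [Fintype ι] {𝔤 : Type*} [LieRing 𝔤] [LieAlgebra ℂ 𝔤]
  {H : LieSubalgebra ℂ 𝔤} (bs : LieAlgebra.Basis ι H)
  (V : ι → Type*) [∀ i, AddCommGroup (V i)] [∀ i, Module ℂ (V i)]
  [∀ i, LieRingModule 𝔤 (V i)] [∀ i, LieModule ℂ 𝔤 (V i)]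

/-- The entry `a_{ij} = ⟨α_j, α̌_i⟩` of the Cartan matrix. (In Mathlib `⁅h j, e i⁆ = A i j • e i`,
so that `A i j = ⟨α_i, α̌_j⟩`.) -/
def cartan : Matrix ι ι ℤ := fun i j => bs.A j i

/-- `V i` is the irreducible representation whose highest weight is the `i`-th fundamental weight,
and `ν i` is a highest weight vector in it. -/
structure IsFundamental [DecidableEq ι] (ν : ∀ i, V i) : Prop where
  irreducible : ∀ i, LieModule.IsIrreducible ℂ 𝔤 (V i)
  ne_zero : ∀ i, ν i ≠ 0
  e_zero : ∀ i j, ⁅bs.e j, ν i⁆ = 0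
  weight : ∀ i j, ⁅bs.h j, ν i⁆ = if i = j then ν i else 0

/-- `𝔫₊(z)`; the Lie algebra `𝔫₊` is generated by the `e i`. -/
def nPlus : Submodule RatFn (RatFn ⊗[ℂ] 𝔤) :=
  (LieSubalgebra.lieSpan ℂ 𝔤 (Set.range bs.e)).toSubmodule.baseChange RatFn

/-- `𝔫₋(z)`; the Lie algebra `𝔫₋` is generated by the `f i`. -/
def nMinus : Submodule RatFn (RatFn ⊗[ℂ] 𝔤) :=
  (LieSubalgebra.lieSpan ℂ 𝔤 (Set.range bs.f)).toSubmodule.baseChange RatFn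

/-- `𝔟₊(z)`; the Lie algebra `𝔟₊` is generated by the `e i` and the `α̌ i`. -/
def bPlus : Submodule RatFn (RatFn ⊗[ℂ] 𝔤) :=
  (LieSubalgebra.lieSpan ℂ 𝔤 (Set.range bs.e ∪ Set.range bs.h)).toSubmodule.baseChange RatFn

/-- `𝔟₋(z)`; the Lie algebra `𝔟₋` is generated by the `f i` and the `α̌ i`. -/
def bMinus : Submodule RatFn (RatFn ⊗[ℂ] 𝔤) :=
  (LieSubalgebra.lieSpan ℂ 𝔤 (Set.range bs.f ∪ Set.range bs.h)).toSubmodule.baseChange RatFn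

/-- The linear automorphisms of all the `ℂ(z) ⊗ V i`. The simply connected group `G` acts
faithfully on the sum of its fundamental representations, so `G(z)` is a subgroup. -/
abbrev AmbientGL := ∀ i, LinearMap.GeneralLinearGroup RatFn (RatFn ⊗[ℂ] V i)

/-- The elements `exp x` for `x` in a subspace of `𝔤(z)`, acting on the fundamental
representations. (Only used for subspaces which consist of nilpotent operators.) -/
def expSet (n : Submodule RatFn (RatFn ⊗[ℂ] 𝔤)) : Set (AmbientGL V) :=
  {u | ∃ x ∈ n, ∀ i, (u i : Module.End RatFn (RatFn ⊗[ℂ] V i)) =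
    IsNilpotent.exp (LieModule.toEnd RatFn (RatFn ⊗[ℂ] 𝔤) (RatFn ⊗[ℂ] V i) x)}

/-- The elements `∏ k, y_k ^ α̌_k` with `y_k ∈ ℂ(z)ˣ`: such an element multiplies a vector of weight
`m`, where `m k = ⟨m, α̌_k⟩`, by `∏ k, y_k ^ m_k`. -/
def torusSet : Set (AmbientGL V) :=
  {t | ∃ y : ι → RatFnˣ, ∀ (i : ι) (v : V i) (m : ι → ℤ), (∀ k, ⁅bs.h k, v⁆ = (m k : ℂ) • v) →
    (t i : Module.End RatFn (RatFn ⊗[ℂ] V i)) ((1 : RatFn) ⊗ₜ[ℂ] v) =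
      ((∏ k, y k ^ m k : RatFnˣ) : RatFn) ⊗ₜ[ℂ] v}

/-- `H(z)`. -/
def torus : Subgroup (AmbientGL V) := Subgroup.closure (torusSet bs V)

/-- `N₊(z)`. -/
def NPlus : Subgroup (AmbientGL V) := Subgroup.closure (expSet V (nPlus bs))

/-- `N₋(z)`. -/
def NMinus : Subgroup (AmbientGL V) := Subgroup.closure (expSet V (nMinus bs))

/-- `B₊(z)`. -/
def BPlus : Subgroup (AmbientGL V) := torus bs V ⊔ NPlus bs V

/-- `B₋(z)`. -/
def BMinus : Subgroup (AmbientGL V) := torus bs V ⊔ NMinus bs V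

/-- `G(z)`: the points over the field `ℂ(z)` of the simply connected group with Lie algebra `𝔤`
(the universal Chevalley group), generated by `H(z)`, `N₊(z)` and `N₋(z)`. -/
def GroupG : Subgroup (AmbientGL V) := torus bs V ⊔ NPlus bs V ⊔ NMinus bs V

/-! ### Connections and gauge transformations -/

/-- The connection `∂_z + A` on the `i`-th fundamental representation. -/
def nabla (A : RatFn ⊗[ℂ] 𝔤) (i : ι) : (RatFn ⊗[ℂ] V i) →ₗ[ℂ] (RatFn ⊗[ℂ] V i) :=
  LinearMap.rTensor (V i) (dz : RatFn →ₗ[ℂ] RatFn) +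
    (LieModule.toEnd RatFn (RatFn ⊗[ℂ] 𝔤) (RatFn ⊗[ℂ] V i) A).restrictScalars ℂ

variable {V} in
/-- `∂_z + A' = g (∂_z + A) g⁻¹`, i.e. `A' = g ∂_z(g⁻¹) + g A g⁻¹`. As `𝔤` acts faithfully on the
sum of the fundamental representations, this determines `A'`. -/
def IsGauge (g : AmbientGL V) (A A' : RatFn ⊗[ℂ] 𝔤) : Prop :=
  ∀ (i : ι) (w : RatFn ⊗[ℂ] V i),
    (g i : Module.End RatFn (RatFn ⊗[ℂ] V i)) (nabla V A i w) =
      nabla V A' i ((g i : Module.End RatFn (RatFn ⊗[ℂ] V i)) w)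

variable {V}

theorem IsGauge.one (A : RatFn ⊗[ℂ] 𝔤) : IsGauge (1 : AmbientGL V) A A := fun _ _ => rfl

theorem IsGauge.mul {g g' : AmbientGL V} {A A' A'' : RatFn ⊗[ℂ] 𝔤} (h : IsGauge g A A')
    (h' : IsGauge g' A' A'') : IsGauge (g' * g) A A'' := by
  intro i w
  have e : ∀ v, ((g' * g) i : Module.End RatFn (RatFn ⊗[ℂ] V i)) v =
      (g' i : Module.End RatFn (RatFn ⊗[ℂ] V i)) ((g i : Module.End RatFn (RatFn ⊗[ℂ] V i)) v) :=
    fun _ => rfl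
  rw [e, e, h i w, h' i]

theorem IsGauge.inv {g : AmbientGL V} {A A' : RatFn ⊗[ℂ] 𝔤} (h : IsGauge g A A') :
    IsGauge g⁻¹ A' A := by
  intro i w
  have e1 : ∀ v, (g⁻¹ i : Module.End RatFn (RatFn ⊗[ℂ] V i))
      ((g i : Module.End RatFn (RatFn ⊗[ℂ] V i)) v) = v := fun v => by
    rw [← Module.End.mul_apply]
    simp [← Units.val_mul]
  have e2 : ∀ v, (g i : Module.End RatFn (RatFn ⊗[ℂ] V i))
      ((g⁻¹ i : Module.End RatFn (RatFn ⊗[ℂ] V i)) v) = v := fun v => by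
    rw [← Module.End.mul_apply]
    simp [← Units.val_mul]
  have := h i ((g⁻¹ i : Module.End RatFn (RatFn ⊗[ℂ] V i)) w)
  rw [e2] at this
  rw [← this, e1]

/-- The constant connection matrix attached to an element of `𝔤`. -/
def const (Z : 𝔤) : RatFn ⊗[ℂ] 𝔤 := (1 : RatFn) ⊗ₜ[ℂ] Z

/-- `Z^H = ∑ i, ζ_i α̌_i`. -/
def ZH (ζ : ι → ℂ) : 𝔤 := ∑ i, ζ i • bs.h i

/-- `⟨α_i, Z^H⟩ = ∑ j, a_{ji} ζ_j`. -/
def rootZH (ζ : ι → ℂ) (i : ι) : ℂ := ∑ j, (cartan bs j i : ℂ) * ζ j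

/-- The matrix `∑ g_i α̌_i + ∑ φ_i e_i`. -/
def miuraMatrix (g φ : ι → RatFn) : RatFn ⊗[ℂ] 𝔤 :=
  ∑ i, g i ⊗ₜ[ℂ] bs.h i + ∑ i, φ i ⊗ₜ[ℂ] bs.e i

/-! ### Miura opers -/

variable (V) in
/-- A meromorphic Miura `G`-oper on the projective line, described in a trivialization of the
`G`-bundle over a dense open subset: the connection is `∂_z + conn`, and the reductions to `B₋`
and `B₊` are the cosets `redMinus · B₋(z)` and `redPlus · B₊(z)`. In a trivialization of the
`B₋`-reduction the connection has the form `∂_z + ∑ φ_i e_i + b` with all `φ_i ≠ 0` and `b` in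
`𝔟₋(z)` (oper condition), and the connection preserves the `B₊`-reduction. -/
structure MiuraOper where
  conn : RatFn ⊗[ℂ] 𝔤
  redMinus : AmbientGL V
  redPlus : AmbientGL V
  redMinus_mem : redMinus ∈ GroupG bs V
  redPlus_mem : redPlus ∈ GroupG bs V
  oper : ∃ φ : ι → RatFn, (∀ i, φ i ≠ 0) ∧ ∃ b ∈ bMinus bs,
    IsGauge redMinus⁻¹ conn (∑ i, φ i ⊗ₜ[ℂ] bs.e i + b)
  preserved : ∃ b ∈ bPlus bs, IsGauge redPlus⁻¹ conn b

variable (V) in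
/-- Isomorphism of Miura opers (over a dense open subset of the projective line): a gauge
transformation by an element of `G(z)` that matches the connections and both reductions. -/
def MiuraOper.setoid : Setoid (MiuraOper bs V) where
  r M M' := ∃ x ∈ GroupG bs V, IsGauge x M.conn M'.conn ∧
    (x * M.redMinus)⁻¹ * M'.redMinus ∈ BMinus bs V ∧
    (x * M.redPlus)⁻¹ * M'.redPlus ∈ BPlus bs V
  iseqv :=
    { refl := fun M => ⟨1, one_mem _, IsGauge.one _, by simp [one_mem], by simp [one_mem]⟩
      symm := by
        rintro M M' ⟨x, hx, h, hm, hp⟩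
        refine ⟨x⁻¹, inv_mem hx, h.inv, ?_, ?_⟩
        · have := inv_mem hm
          convert this using 1
          group
        · have := inv_mem hp
          convert this using 1
          group
      trans := by
        rintro M M' M'' ⟨x, hx, h, hm, hp⟩ ⟨x', hx', h', hm', hp'⟩
        refine ⟨x' * x, mul_mem hx' hx, h.mul h', ?_, ?_⟩
        · have := mul_mem hm hm'
          convert this using 1
          group
        · have := mul_mem hp hp'
          convert this using 1
          group }

namespace MiuraOper

variable {bs}

/-- Regular singularities determined by the polynomials `L i`: in some trivialization of the
`B₋`-reduction the connection is `∂_z + ∑ L_i e_i + b` with `b` in `𝔟₋(z)`. -/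
def HasRegularSingularities (L : ι → ℂ[X]) (M : MiuraOper bs V) : Prop :=
  ∃ x ∈ BMinus bs V, ∃ b ∈ bMinus bs,
    IsGauge (M.redMinus * x)⁻¹ M.conn (∑ i, ofPoly (L i) ⊗ₜ[ℂ] bs.e i + b)

/-- In some trivialization of the `G`-bundle compatible with both reductions, the connection is
`∂_z + ∑ L_i e_i + ∑ g_i α̌_i`. -/
def HasMiuraForm (L : ι → ℂ[X]) (g : ι → RatFn) (M : MiuraOper bs V) : Prop :=
  ∃ x ∈ GroupG bs V, M.redMinus⁻¹ * x ∈ BMinus bs V ∧ M.redPlus⁻¹ * x ∈ BPlus bs V ∧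
    IsGauge x⁻¹ M.conn (miuraMatrix bs g fun i => ofPoly (L i))

/-- The `B₊(z)`-stable plane `W_i(z)` in `V_i(z)` spanned by `ν_i` and `f_i ν_i`. -/
def plane (bs : LieAlgebra.Basis ι H) (ν : ∀ i, V i) (i : ι) : Submodule RatFn (RatFn ⊗[ℂ] V i) :=
  (Submodule.span ℂ {ν i, ⁅bs.f i, ν i⁆}).baseChange RatFn

/-- The `Z`-twisted Miura–Plücker condition: in a trivialization of the `B₊`-reduction, the
connections `∇_i` induced on the planes `W_i` are simultaneously `v (∂_z + Z) v⁻¹` on `W_i`, for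
one element `v` of `B₊(z)`. -/
def IsTwistedMiuraPlucker (ν : ∀ i, V i) (Z : 𝔤) (M : MiuraOper bs V) : Prop :=
  ∃ A ∈ bPlus bs, IsGauge M.redPlus⁻¹ M.conn A ∧
    ∃ v ∈ BPlus bs V, ∀ i, ∀ w ∈ plane bs ν i,
      nabla V A i w = (v i : Module.End RatFn (RatFn ⊗[ℂ] V i))
        (nabla V (const Z) i ((v⁻¹ i : Module.End RatFn (RatFn ⊗[ℂ] V i)) w))

variable [DecidableEq ι]

/-- Nondegeneracy of a `Z^H`-twisted Miura–Plücker oper: its Cartan connection is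
`∂_z + ∑ (ζ_i - y_i'/y_i) α̌_i` with `y_i` satisfying the conditions of `H`-nondegeneracy, and each
associated Miura `SL(2)`-oper `∂_z + g_i α̌_i + ρ_i e_i`, with
`ρ_i = L_i ∏_{k ≠ i} y_k ^ (-a_{ki})`, is nondegenerate. (For `SL(2)` itself `ρ = L`, and the
`SL(2)`-oper is the given one.) -/
def IsNondegenerate (ζ : ι → ℂ) (L : ι → ℂ[X]) (M : MiuraOper bs V) : Prop :=
  ∃ g y : ι → RatFn, M.HasMiuraForm L g ∧ (∀ i, g i = ofPoly (C (ζ i)) - dz (y i) / y i) ∧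
    YNondegenerate (cartan bs) (fun i => ofPoly (L i)) y ∧
    ∀ i, SL2Nondegenerate (ζ i)
      (ofPoly (L i) * ∏ k ∈ Finset.univ.erase i, y k ^ (-cartan bs k i)) (g i)

end MiuraOper

variable [DecidableEq ι]

/-- The set of nondegenerate `Z^H`-twisted Miura–Plücker `G`-opers with regular singularities
determined by the `L i`, up to isomorphism. -/
def NondegMPOper (ν : ∀ i, V i) (ζ : ι → ℂ) (L : ι → ℂ[X]) : Type _ :=
  {c : Quotient (MiuraOper.setoid bs V) // ∃ M : MiuraOper bs V, Quotient.mk _ M = c ∧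
    M.HasRegularSingularities L ∧ M.IsTwistedMiuraPlucker ν (ZH bs ζ) ∧ M.IsNondegenerate ζ L}

/-! ### The `qq`-system and the Bethe Ansatz equations -/

/-- Nondegenerate polynomial solutions of the `qq`-system. -/
@[ext]
structure NondegQQSolution (ζ : ι → ℂ) (L : ι → ℂ[X]) where
  qPlus : ι → ℂ[X]
  qMinus : ι → ℂ[X]
  eqn : ∀ i,
    ofPoly (qPlus i * derivative (qMinus i) - qMinus i * derivative (qPlus i) +
        C (rootZH bs ζ i) * qPlus i * qMinus i) =
      ofPoly (L i) * ∏ j ∈ Finset.univ.erase i, ofPoly (qPlus j) ^ (-cartan bs j i)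
  monic : ∀ i, (qPlus i).Monic
  nondeg : YNondegenerate (cartan bs) (fun i => ofPoly (L i)) fun i => ofPoly (qPlus i)

/-- Solutions of the Bethe Ansatz equations: the `i`-th set consists of the numbers `w^i_ℓ`, which
are pairwise distinct. The equations are
`⟨α_i, Z^H⟩ + ∂_z log (L_i ∏_j q_j ^ (-a_{ji}) (z - w)²) = 0` at `z = w`, where `w = w^i_ℓ` and
`q_j = ∏_s (z - w^j_s)`; the conditions `not_root` and `ne` are those under which they make
sense. -/
@[ext]
structure BetheSolution (ζ : ι → ℂ) (L : ι → ℂ[X]) where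
  roots : ι → Finset ℂ
  not_root : ∀ i, ∀ w ∈ roots i, ¬ (L i).IsRoot w
  ne : ∀ i j, i ≠ j → cartan bs j i ≠ 0 → Disjoint (roots i) (roots j)
  eqn : ∀ i, ∀ w ∈ roots i, ∀ F : RatFn,
    F = ofPoly (L i) * (∏ j, ofPoly (∏ s ∈ roots j, (X - C s)) ^ (-cartan bs j i)) *
      ofPoly ((X - C w) ^ 2) →
    rootZH bs ζ i + RatFunc.eval (RingHom.id ℂ) w (dz F / F) = 0

/-- The class `c` is that of the oper attached to `q`, i.e. of the connection
`∂_z + ∑ (ζ_i - q₊^i' / q₊^i) α̌_i + ∑ L_i e_i` with the standard reductions. -/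
def IsOperOf {ν : ∀ i, V i} {ζ : ι → ℂ} {L : ι → ℂ[X]} (q : NondegQQSolution bs ζ L)
    (c : NondegMPOper bs ν ζ L) : Prop :=
  ∃ M : MiuraOper bs V, Quotient.mk _ M = c.1 ∧ M.redMinus = 1 ∧ M.redPlus = 1 ∧
    M.conn = miuraMatrix bs
      (fun i => ofPoly (C (ζ i)) - dz (ofPoly (q.qPlus i)) / ofPoly (q.qPlus i))
      fun i => ofPoly (L i)

end Group

end MiuraPlucker

end

/-!
The proof is elementary once everything is restricted to the planes `W_i`. By
`IsFundamental.BPlus_le_triangular`, an element of `B₊(z)` acts on `W_i` by an upper triangular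
matrix with diagonal entries `t_i`, `s_i` and off-diagonal entry `c_i`. By
`IsFundamental.intertwines_iff`, it intertwines `∂_z + Z^H` with the connection
`∂_z + ∑ (ζ_i - y_i'/y_i) α̌_i + ∑ L_i e_i` on all `W_i` if and only if `t_i`, `s_i` and `c_i`
satisfy three first order equations. The first two determine `t_i = y_i` and
`s_i = y_i ∏_k y_k ^ (-a_{ki})` up to constants, and for this choice the third says that `-c_i`
solves the `i`-th equation of the `qq`-system for `q₊ = y` (`off_diagonal_iff`).

Well-definedness of the map to opers therefore needs an element of `B₊(z)` with given `t_i = q₊^i`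
and `c_i = -q₋^i`. It is the product of a torus element and an exponential of `∑ x_i e_i`
(`IsFundamental.exists_mem_BPlus`); to construct them, one uses that a fundamental representation
is spanned by the weight vectors `f_{j₁} ⋯ f_{jₙ} ν`, by irreducibility. Conversely, a
Miura–Plücker oper gives a rational solution `q₋`, and it is a polynomial because `q₊` has simple
roots (`exists_ofPoly_of_wronskian_eq`). If two standard opers are isomorphic, the
isomorphism lies in `B₊(z) ∩ B₋(z)`, so all `c_i` vanish; then the intertwining equations and the
nondegeneracy of the Cartan matrix force the two Cartan connections to agree
(`IsFundamental.eq_of_standardOper_equiv`).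

The passage between the `qq`-system and the Bethe Ansatz equations is a statement about a single
equation `Q f' - f Q' + r Q f = ρ` for polynomials, with `Q` having simple roots: it has a
polynomial solution `f` if and only if `r + ρ'/ρ - Q''/Q'` vanishes at the roots of `Q`
(`exists_wronskian_eq`, `bethe_of_wronskian_eq`). Both maps have the same fibres, which yields the
bijection.
-/

noncomputable section

namespace MiuraPlucker

open Polynomial

/-! ### Rational functions and their logarithmic derivatives -/

theorem ofPoly_injective : Function.Injective ofPoly :=
  IsFractionRing.injective ℂ[X] RatFn

theorem ofPoly_ne_zero {p : ℂ[X]} (hp : p ≠ 0) : ofPoly p ≠ 0 := by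
  simpa [ofPoly] using hp

theorem dz_mul (f g : RatFn) : dz (f * g) = f * dz g + g * dz f := by
  simp [Derivation.leibniz]

/-- The constants of the differential field `ℂ(z)` are the complex numbers. -/
theorem exists_eq_C_of_dz_eq_zero {f : RatFn} (h : dz f = 0) : ∃ c : ℂ, f = ofPoly (C c) := by
  have hd : f.denom ≠ 0 := f.denom_ne_zero
  have h' : derivative f.num * f.denom = f.num * derivative f.denom := by
    have h0 : (ofPoly (derivative f.num) * ofPoly f.denom
        - ofPoly f.num * ofPoly (derivative f.denom)) / ofPoly f.denom ^ 2 = 0 := h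
    rw [div_eq_zero_iff, or_iff_left (pow_ne_zero 2 (ofPoly_ne_zero hd)), sub_eq_zero] at h0
    apply ofPoly_injective
    simpa [ofPoly] using h0
  have hdvd : f.denom ∣ derivative f.denom :=
    f.isCoprime_num_denom.symm.dvd_of_dvd_mul_left ⟨derivative f.num, by rw [← h', mul_comm]⟩
  have hd0 : derivative f.denom = 0 := by
    by_contra h0
    exact absurd (Polynomial.degree_le_of_dvd hdvd h0) (not_le.2 (degree_derivative_lt hd))
  have hn0 : derivative f.num = 0 := by
    rw [hd0, mul_zero] at h'
    exact (mul_eq_zero.1 h').resolve_right hd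
  have hdc := eq_C_of_derivative_eq_zero hd0
  have hnc := eq_C_of_derivative_eq_zero hn0
  refine ⟨f.num.coeff 0 / f.denom.coeff 0, ?_⟩
  have hd1 : f.denom.coeff 0 ≠ 0 := fun h => hd (by rw [hdc, h, C_0])
  rw [eq_comm, ← RatFunc.num_div_denom f, eq_div_iff (ofPoly_ne_zero hd), ← map_mul]
  congr 1
  rw [RatFunc.num_div_denom f]
  generalize f.num.coeff 0 = a at *
  generalize f.denom.coeff 0 = b at *
  rw [hdc, hnc, ← C_mul, div_mul_cancel₀ _ hd1]

theorem dz_C (c : ℂ) : dz (ofPoly (C c)) = 0 := by rw [dz_ofPoly, derivative_C]; exact map_zero _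

theorem exists_eq_C_mul_of_dlog_eq {f g : RatFn} (hf : f ≠ 0) (hg : g ≠ 0)
    (h : dz f / f = dz g / g) : ∃ c : ℂ, c ≠ 0 ∧ f = ofPoly (C c) * g := by
  have h1 : dz (f / g) = 0 := by
    rw [Derivation.leibniz_div]
    rw [div_eq_div_iff hf hg] at h
    simp only [smul_eq_mul]
    rw [mul_eq_zero]; right
    linear_combination h
  obtain ⟨c, hc⟩ := exists_eq_C_of_dz_eq_zero h1
  rw [div_eq_iff hg] at hc
  refine ⟨c, ?_, hc⟩
  rintro rfl
  exact hf (by simp [hc, ofPoly])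

theorem dlog_C_mul {c : ℂ} (hc : c ≠ 0) (f : RatFn) :
    dz (ofPoly (C c) * f) / (ofPoly (C c) * f) = dz f / f := by
  have hc' : ofPoly (C c) ≠ 0 := ofPoly_ne_zero (by simpa using hc)
  rw [dz_mul, dz_C, mul_zero, add_zero, mul_div_mul_left _ _ hc']

theorem dlog_mul {f g : RatFn} (hf : f ≠ 0) (hg : g ≠ 0) :
    dz (f * g) / (f * g) = dz f / f + dz g / g := by
  rw [dz_mul]; field_simp; ring

theorem dlog_zpow {f : RatFn} (hf : f ≠ 0) (n : ℤ) :
    dz (f ^ n) / f ^ n = n * (dz f / f) := by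
  have hnat : ∀ n : ℕ, dz (f ^ n) / f ^ n = n * (dz f / f) := by
    intro n
    induction n with
    | zero => simp
    | succ n ih =>
      rw [pow_succ, dlog_mul (pow_ne_zero n hf) hf, ih]
      push_cast; ring
  obtain ⟨n, rfl | rfl⟩ := n.eq_nat_or_neg
  · simpa using hnat n
  · have h1 := dlog_mul (pow_ne_zero n hf) (inv_ne_zero (pow_ne_zero n hf))
    rw [mul_inv_cancel₀ (pow_ne_zero n hf), hnat] at h1
    simp only [zpow_neg, zpow_natCast, Int.cast_neg, Int.cast_natCast]
    simp only [Derivation.map_one_eq_zero, zero_div] at h1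
    linear_combination -h1

theorem dlog_prod {κ : Type*} (s : Finset κ) (f : κ → RatFn) (hf : ∀ j ∈ s, f j ≠ 0) :
    dz (∏ j ∈ s, f j) / (∏ j ∈ s, f j) = ∑ j ∈ s, dz (f j) / f j := by
  classical
  induction s using Finset.induction_on with
  | empty => simp
  | insert a s ha ih =>
    rw [Finset.prod_insert ha, Finset.sum_insert ha, dlog_mul (hf a (by simp))
      (Finset.prod_ne_zero_iff.2 fun j hj => hf j (by simp [hj])),
      ih fun j hj => hf j (by simp [hj])]

theorem eval_ofPoly_div {p q : ℂ[X]} {w : ℂ} (hq : q.eval w ≠ 0) :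
    RatFunc.eval (RingHom.id ℂ) w (ofPoly p / ofPoly q) = p.eval w / q.eval w := by
  have hq0 : q ≠ 0 := by rintro rfl; simp at hq
  have hdvd : (ofPoly p / ofPoly q).denom ∣ q := RatFunc.denom_div_dvd p q
  have hw : (ofPoly p / ofPoly q).denom.eval w ≠ 0 := by
    obtain ⟨r, hr⟩ := hdvd
    intro h0
    apply hq
    rw [hr, eval_mul, h0, zero_mul]
  have h := RatFunc.eval_mul (f := RingHom.id ℂ) (a := w) (x := ofPoly p / ofPoly q)
    (y := ofPoly q) (by simpa using hw) (by simp [ofPoly])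
  rw [div_mul_cancel₀ _ (ofPoly_ne_zero hq0)] at h
  simp only [ofPoly, RatFunc.eval_algebraMap, eval₂_id] at h
  rw [eq_div_iff hq]
  exact h.symm

/-- Admissibility of polynomials in terms of their roots. -/
theorem yNondegenerate_ofPoly_iff {κ : Type*} (a : Matrix κ κ ℤ) (L q : κ → ℂ[X]) :
    YNondegenerate a (fun i => ofPoly (L i)) (fun i => ofPoly (q i)) ↔
      (∀ i, q i ≠ 0) ∧ (∀ i w, (q i).rootMultiplicity w ≤ 1) ∧
      (∀ i w, (L i).IsRoot w → ¬ (q i).IsRoot w) ∧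
      ∀ i j w, i ≠ j → a i j ≠ 0 → (q i).IsRoot w → ¬ (q j).IsRoot w := by
  have key : ∀ (p : ℂ[X]) w, IsZeroOrPoleOf (ofPoly p) w ↔ p.IsRoot w := by
    intro p w
    simp [IsZeroOrPoleOf, IsZeroOf, IsPoleOf, ofPoly, RatFunc.num_algebraMap]
  constructor
  · intro h
    refine ⟨fun i h0 => h.ne_zero i (by simp [h0, ofPoly]), fun i w => ?_, fun i w hw => ?_,
      fun i j w hij ha hw => ?_⟩
    · have := (h.simple i w).1
      simpa [ofPoly, RatFunc.num_algebraMap] using this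
    · rw [← key]
      exact h.disjoint_sing i w (by simpa [IsZeroOf, ofPoly, RatFunc.num_algebraMap] using hw)
    · rw [← key] at hw ⊢
      exact h.disjoint i j w hij ha hw
  · rintro ⟨h1, h2, h3, h4⟩
    refine ⟨fun i => ofPoly_ne_zero (h1 i), fun i w => ?_, fun i w hw => ?_,
      fun i j w hij ha hw => ?_⟩
    · refine ⟨by simpa [ofPoly, RatFunc.num_algebraMap] using h2 i w, ?_⟩
      rw [show (ofPoly (q i)).denom = C 1 by simp [ofPoly], rootMultiplicity_C]; exact zero_le_one
    · rw [key]
      exact h3 i w (by simpa [IsZeroOf, ofPoly, RatFunc.num_algebraMap] using hw)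
    · rw [key] at hw ⊢
      exact h4 i j w hij ha hw

/-! ### The equation `Q f' - f Q' + r Q f = ρ` -/

theorem derivative_eval_ne_zero {Q : ℂ[X]} (hQ : Q ≠ 0) {w : ℂ} (hm : Q.rootMultiplicity w ≤ 1)
    (hw : Q.IsRoot w) : (derivative Q).eval w ≠ 0 := by
  intro h
  have := (Polynomial.one_lt_rootMultiplicity_iff_isRoot hQ).2 ⟨hw, h⟩
  omega

/-- Rational solutions are polynomials when `Q` has simple roots: at a pole of `f` of order `n`, the
left-hand side has a pole of order `n + 1` if `Q` does not vanish there, and one of order `n`, with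
leading coefficient proportional to `n + 1`, if it does. -/
theorem exists_ofPoly_of_wronskian_eq {Q ρ : ℂ[X]} {r : ℂ} (hQ : Q ≠ 0)
    (hm : ∀ w, Q.rootMultiplicity w ≤ 1) {f : RatFn}
    (h : ofPoly Q * dz f - f * ofPoly (derivative Q) + ofPoly (C r) * ofPoly Q * f = ofPoly ρ) :
    ∃ p : ℂ[X], f = ofPoly p := by
  set p := f.num with hp
  set d := f.denom with hd
  have hd0 : d ≠ 0 := f.denom_ne_zero
  have hd0' := ofPoly_ne_zero hd0
  have hf : f = ofPoly p / ofPoly d := (RatFunc.num_div_denom f).symm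
  have hcop : IsCoprime p d := f.isCoprime_num_denom
  have hdf : dz f = (ofPoly (derivative p) * ofPoly d - ofPoly p * ofPoly (derivative d)) /
      ofPoly d ^ 2 := rfl
  -- The equation with denominators cleared; `d` is a constant unless it has a root `w`.
  have hpoly : Q * (derivative p * d - p * derivative d) - p * derivative Q * d + C r * Q * p * d
      = ρ * d ^ 2 := by
    apply ofPoly_injective
    rw [hdf, hf] at h
    field_simp at h
    simp only [ofPoly, map_add, map_sub, map_mul, map_pow] at h ⊢
    linear_combination h
  by_cases hdeg : d.degree = 0
  · obtain ⟨c, hc⟩ : ∃ c, d = C c := ⟨_, eq_C_of_degree_eq_zero hdeg⟩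
    have hc0 : c ≠ 0 := by rintro rfl; simp [hc] at hd0
    refine ⟨C c⁻¹ * p, ?_⟩
    rw [hf, div_eq_iff hd0', hc, ← map_mul]
    congr 1
    rw [mul_right_comm, ← C_mul, inv_mul_cancel₀ hc0, C_1, one_mul]
  exfalso
  obtain ⟨w, hw⟩ := IsAlgClosed.exists_root d hdeg
  obtain ⟨d₁, hd₁, hndvd⟩ := exists_eq_pow_rootMultiplicity_mul_and_not_dvd d hd0 w
  have hn : 0 < d.rootMultiplicity w := (rootMultiplicity_pos hd0).2 hw
  obtain ⟨n, hn'⟩ : ∃ n, d.rootMultiplicity w = n + 1 := ⟨_, (Nat.succ_pred_eq_of_pos hn).symm⟩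
  rw [hn'] at hd₁
  have hd₁w : d₁.eval w ≠ 0 := fun h0 => hndvd (dvd_iff_isRoot.2 h0)
  have hpw : p.eval w ≠ 0 := by
    intro h0
    obtain ⟨a, b, hab⟩ := hcop
    have := congrArg (eval w) hab
    rw [IsRoot.def] at hw
    simp [h0, hw] at this
  have hXne : (X - C w : ℂ[X]) ≠ 0 := X_sub_C_ne_zero w
  have hder : derivative d = (X - C w) ^ n * (C ((n : ℂ) + 1) * d₁ + (X - C w) * derivative d₁) := by
    rw [hd₁, derivative_mul, derivative_X_sub_C_pow]
    simp only [Nat.cast_add, Nat.cast_one, Nat.add_sub_cancel, C_add, C_1]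
    simp
    ring
  -- Both sides divided by `(X - w) ^ n`; at `w` this gives `Q(w) = 0`.
  have e1 : Q * (derivative p * (X - C w) * d₁
      - p * (C ((n : ℂ) + 1) * d₁ + (X - C w) * derivative d₁))
      - p * derivative Q * (X - C w) * d₁ + C r * Q * p * (X - C w) * d₁
      = ρ * (X - C w) * d₁ * d := by
    apply mul_left_cancel₀ (pow_ne_zero n hXne)
    rw [hder] at hpoly
    conv_lhs at hpoly => rw [hd₁]
    have : (X - C w) ^ n * (ρ * (X - C w) * d₁ * d) = ρ * d ^ 2 := by
      conv_rhs => rw [sq]; enter [2, 1]; rw [hd₁]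
      ring
    rw [this, ← hpoly]
    ring
  have hn1 : (n : ℂ) + 1 ≠ 0 := by exact_mod_cast Nat.succ_ne_zero n
  have hQw : Q.eval w = 0 := by
    have := congrArg (eval w) e1
    simpa [hpw, hd₁w, hn1] using this
  obtain ⟨Q₁, hQ₁⟩ := dvd_iff_isRoot.2 hQw
  have hQ'w : (derivative Q).eval w = Q₁.eval w := by simp [hQ₁]
  have hQ₁w : Q₁.eval w ≠ 0 := hQ'w ▸ derivative_eval_ne_zero hQ (hm w) hQw
  -- A further factor `X - w` cancels; what remains at `w` is a nonzero multiple of `n + 2`.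
  have e2 : Q₁ * (derivative p * (X - C w) * d₁
      - p * (C ((n : ℂ) + 1) * d₁ + (X - C w) * derivative d₁))
      - p * derivative Q * d₁ + C r * Q * p * d₁ = ρ * d₁ * d := by
    apply mul_left_cancel₀ hXne
    have e3 := e1
    nth_rw 1 [hQ₁] at e3
    linear_combination e3
  have e4 := congrArg (eval w) e2
  rw [IsRoot.def] at hw
  simp only [eval_add, eval_sub, eval_mul, eval_X, eval_C, sub_self, hw, hQw, hQ'w] at e4
  have e5 : Q₁.eval w * p.eval w * d₁.eval w * ((n : ℂ) + 2) = 0 := by linear_combination -e4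
  have hn2 : (n : ℂ) + 2 ≠ 0 := by exact_mod_cast Nat.succ_ne_zero (n + 1)
  simp [hQ₁w, hpw, hd₁w, hn2] at e5

theorem exists_derivative_add_C_mul_eq (r : ℂ) (τ : ℂ[X]) :
    ∃ h : ℂ[X], derivative h + C r * h = τ := by
  let T : ℂ[X] →ₗ[ℂ] ℂ[X] := derivative + LinearMap.mulLeft ℂ (C r)
  suffices ∀ n : ℕ, (X ^ n : ℂ[X]) ∈ LinearMap.range T by
    have htop : ∀ τ : ℂ[X], τ ∈ LinearMap.range T := by
      intro τ
      induction τ using Polynomial.induction_on' with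
      | add p q hp hq => exact add_mem hp hq
      | monomial n a =>
        rw [← C_mul_X_pow_eq_monomial, ← smul_eq_C_mul]
        exact Submodule.smul_mem _ _ (this n)
    obtain ⟨h, hh⟩ := htop τ
    exact ⟨h, by simpa [T] using hh⟩
  intro n
  by_cases hr : r = 0
  · subst hr
    refine ⟨C ((n : ℂ) + 1)⁻¹ * X ^ (n + 1), ?_⟩
    have hn1 : (n : ℂ) + 1 ≠ 0 := by exact_mod_cast Nat.succ_ne_zero n
    simp only [T, LinearMap.add_apply, LinearMap.mulLeft_apply, C_0, zero_mul, add_zero,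
      derivative_C_mul, derivative_X_pow, Nat.add_sub_cancel, Nat.cast_add, Nat.cast_one]
    rw [← mul_assoc, ← C_mul, inv_mul_cancel₀ hn1, C_1, one_mul]
  · have hC : C r * C r⁻¹ = (1 : ℂ[X]) := by rw [← C_mul, mul_inv_cancel₀ hr, C_1]
    induction n with
    | zero => exact ⟨C r⁻¹, by simp [T, hC]⟩
    | succ n ih =>
      have h1 : T (C r⁻¹ * X ^ (n + 1)) = (r⁻¹ * ((n : ℂ) + 1)) • X ^ n + X ^ (n + 1) := by
        simp only [T, LinearMap.add_apply, LinearMap.mulLeft_apply, derivative_C_mul,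
          derivative_X_pow, Nat.add_sub_cancel, Nat.cast_add, Nat.cast_one, smul_eq_C_mul, C_mul]
        linear_combination (X ^ (n + 1)) * hC
      have h2 : (X ^ (n + 1) : ℂ[X]) = T (C r⁻¹ * X ^ (n + 1)) - (r⁻¹ * ((n : ℂ) + 1)) • X ^ n := by
        rw [h1]; ring
      rw [h2]
      exact sub_mem ⟨_, rfl⟩ (Submodule.smul_mem _ _ ih)

theorem prod_X_sub_C_dvd {S : Finset ℂ} {p : ℂ[X]} (h : ∀ w ∈ S, p.eval w = 0) :
    ∏ s ∈ S, (X - C s) ∣ p :=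
  Finset.prod_dvd_of_coprime
    (fun _ _ _ _ hab => isCoprime_X_sub_C_of_isUnit_sub (sub_ne_zero.2 hab).isUnit)
    fun w hw => dvd_iff_isRoot.2 (h w hw)

theorem eval_prod_X_sub_C_eq_zero_iff {S : Finset ℂ} {w : ℂ} :
    (∏ s ∈ S, (X - C s)).eval w = 0 ↔ w ∈ S := by
  simp [eval_prod, Finset.prod_eq_zero_iff, sub_eq_zero]

theorem prod_X_sub_C_monic (S : Finset ℂ) : (∏ s ∈ S, (X - C s)).Monic :=
  monic_prod_of_monic _ _ fun s _ => monic_X_sub_C s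

theorem rootMultiplicity_prod_X_sub_C_le (S : Finset ℂ) (w : ℂ) :
    (∏ s ∈ S, (X - C s)).rootMultiplicity w ≤ 1 := by
  rw [← count_roots, roots_prod_X_sub_C]
  exact Multiset.nodup_iff_count_le_one.1 S.nodup w

/-- The Bethe Ansatz equations at the roots of `Q` imply that a polynomial solution exists. A
polynomial `f₀` with `-f₀ Q' = ρ` at the roots of `Q` leaves, by these equations, a remainder
divisible by `Q²`, and `f ↦ Q f' - f Q' + r Q f` sends `Q h` to `Q² (h' + r h)`. -/
theorem exists_wronskian_eq {S : Finset ℂ} {ρ : ℂ[X]} {r : ℂ} {Q : ℂ[X]}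
    (hQ : Q = ∏ s ∈ S, (X - C s))
    (h : ∀ w ∈ S, (r * ρ.eval w + (derivative ρ).eval w) * (derivative Q).eval w =
      ρ.eval w * (derivative (derivative Q)).eval w) :
    ∃ f : ℂ[X], Q * derivative f - f * derivative Q + C r * Q * f = ρ := by
  have hroot : ∀ w ∈ S, Q.eval w = 0 := fun w hw => hQ ▸ eval_prod_X_sub_C_eq_zero_iff.2 hw
  have hsimple : ∀ w ∈ S, (derivative Q).eval w ≠ 0 := fun w hw =>
    derivative_eval_ne_zero (hQ ▸ (prod_X_sub_C_monic S).ne_zero)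
      (hQ ▸ rootMultiplicity_prod_X_sub_C_le S w) (hroot w hw)
  let f₀ := Lagrange.interpolate S id fun w => -(ρ.eval w / (derivative Q).eval w)
  have hf₀ : ∀ w ∈ S, f₀.eval w = -(ρ.eval w / (derivative Q).eval w) := fun w hw =>
    Lagrange.eval_interpolate_at_node (v := id) _ Function.injective_id.injOn hw
  have h1 : Q ∣ ρ - (Q * derivative f₀ - f₀ * derivative Q + C r * Q * f₀) := by
    conv_lhs => rw [hQ]
    refine prod_X_sub_C_dvd fun w hw => ?_
    have := hsimple w hw
    simp only [eval_add, eval_sub, eval_mul, hroot w hw, hf₀ w hw, eval_C]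
    field_simp
    ring
  obtain ⟨σ, hσ⟩ := h1
  have h2 : Q ∣ σ := by
    conv_lhs => rw [hQ]
    refine prod_X_sub_C_dvd fun w hw => ?_
    have e := congrArg (fun p => (derivative p).eval w) hσ
    simp only [derivative_add, derivative_sub, derivative_mul, derivative_C, eval_add, eval_sub,
      eval_mul, hroot w hw, hf₀ w hw, eval_C, eval_zero] at e
    have hs := hsimple w hw
    have hh := h w hw
    have e' : σ.eval w * (derivative Q).eval w ^ 2 = 0 := by
      field_simp at e
      linear_combination hh - e
    simpa [hs] using e'
  obtain ⟨τ, rfl⟩ := h2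
  obtain ⟨g, hg⟩ := exists_derivative_add_C_mul_eq r τ
  refine ⟨f₀ + Q * g, ?_⟩
  rw [derivative_add, derivative_mul]
  linear_combination Q ^ 2 * hg - hσ

/-- Conversely, a polynomial solution yields the Bethe Ansatz equation at each root of `Q`. -/
theorem bethe_of_wronskian_eq {Q f ρ : ℂ[X]} {r w : ℂ}
    (h : Q * derivative f - f * derivative Q + C r * Q * f = ρ) (hw : Q.eval w = 0) :
    (r * ρ.eval w + (derivative ρ).eval w) * (derivative Q).eval w =
      ρ.eval w * (derivative (derivative Q)).eval w := by
  subst h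
  simp only [derivative_add, derivative_sub, derivative_mul, derivative_C, eval_add, eval_sub,
    eval_mul, hw, eval_C, eval_zero]
  ring

/-- The logarithmic derivative in the Bethe Ansatz equations. If `Q = (z - w) Q₁`, then
`Q' = Q₁` and `Q'' = 2 Q₁'` at `w`. -/
theorem eval_dlog_bethe {Q ρ : ℂ[X]} {w : ℂ} (hQ : Q.eval w = 0)
    (hQ' : (derivative Q).eval w ≠ 0) (hρ : ρ.eval w ≠ 0) {F : RatFn}
    (hF : F = ofPoly ρ * ofPoly Q ^ (-2 : ℤ) * ofPoly ((X - C w) ^ 2)) :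
    RatFunc.eval (RingHom.id ℂ) w (dz F / F) =
      (derivative ρ).eval w / ρ.eval w -
        (derivative (derivative Q)).eval w / (derivative Q).eval w := by
  obtain ⟨Q₁, rfl⟩ := dvd_iff_isRoot.2 hQ
  have hX : (X - C w : ℂ[X]) ≠ 0 := X_sub_C_ne_zero w
  have hQ₁w : Q₁.eval w ≠ 0 := by simpa using hQ'
  have hQ₁ : Q₁ ≠ 0 := by rintro rfl; simp at hQ₁w
  have hρ0 : ρ ≠ 0 := by rintro rfl; simp at hρ
  have hX' := ofPoly_ne_zero hX
  have hQ₁' := ofPoly_ne_zero hQ₁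
  have hρ' := ofPoly_ne_zero hρ0
  have hF' : F = ofPoly ρ * ofPoly Q₁ ^ (-2 : ℤ) := by
    rw [hF]
    simp only [ofPoly, map_mul, map_pow] at *
    rw [zpow_neg, zpow_neg]
    simp only [zpow_ofNat]
    field_simp
  have hd : dz F / F = ofPoly (derivative ρ * Q₁ - 2 * ρ * derivative Q₁) / ofPoly (ρ * Q₁) := by
    rw [hF', dlog_mul hρ' (zpow_ne_zero _ hQ₁'), dlog_zpow hQ₁', dz_ofPoly, dz_ofPoly]
    simp only [ofPoly, map_sub, map_mul, map_ofNat] at *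
    push_cast
    field_simp
    ring
  rw [hd, eval_ofPoly_div (by simp [hρ, hQ₁w])]
  simp
  field_simp
  ring

/-! ### Highest weight modules -/

section HighestWeight

variable {ι : Type*} [Fintype ι] {𝔤 : Type*} [LieRing 𝔤] [LieAlgebra ℂ 𝔤]
  {H : LieSubalgebra ℂ 𝔤} (bs : LieAlgebra.Basis ι H)
  {W : Type*} [AddCommGroup W] [Module ℂ W] [LieRingModule 𝔤 W] [LieModule ℂ 𝔤 W]

/-- `ν` is annihilated by the `e j` and has the integral weight `c`, where `c j = ⟨c, α̌_j⟩`. -/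
structure IsHighestWeight (c : ι → ℤ) (ν : W) : Prop where
  e_zero : ∀ j, ⁅bs.e j, ν⁆ = 0
  weight : ∀ j, ⁅bs.h j, ν⁆ = (c j : ℂ) • ν

/-- The vector `f_{j₁} ⋯ f_{jₙ} ν`. -/
def word (ν : W) : List ι → W
  | [] => ν
  | j :: l => ⁅bs.f j, word ν l⁆

/-- The weight of `f_{j₁} ⋯ f_{jₙ} ν`, where `c` is the weight of `ν`. -/
def wordWeight (c : ι → ℤ) (l : List ι) (k : ι) : ℤ := c k - (l.map fun j => bs.A j k).sum

/-- The span of the vectors `f_{j₁} ⋯ f_{jₘ} ν` with `m < n`. -/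
def wordFiltration (ν : W) (n : ℕ) : Submodule ℂ W :=
  Submodule.span ℂ (word bs ν '' {l | l.length < n})

/-- The span of the vectors `f_{j₁} ⋯ f_{jₘ} ν` with `0 < m`: the sum of the weight spaces other
than the highest weight line, when `ν` generates an irreducible module. -/
def lowerPart (ν : W) : Submodule ℂ W :=
  Submodule.span ℂ (word bs ν '' {l | l ≠ []})

variable {bs} {c : ι → ℤ} {ν : W}

theorem IsHighestWeight.lie_h_word (hν : IsHighestWeight bs c ν) (l : List ι) (k : ι) :
    ⁅bs.h k, word bs ν l⁆ = (wordWeight bs c l k : ℂ) • word bs ν l := by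
  induction l with
  | nil => simpa [word, wordWeight] using hν.weight k
  | cons j l ih =>
    rw [word, leibniz_lie, ih, bs.lie_h_f, lie_smul, ← Int.cast_smul_eq_zsmul ℂ, smul_lie,
      ← add_smul]
    congr 1
    simp only [wordWeight, List.map_cons, List.sum_cons]
    push_cast; ring

theorem IsHighestWeight.lie_e_word [DecidableEq ι] (hν : IsHighestWeight bs c ν) (l : List ι)
    (k : ι) :
    ⁅bs.e k, word bs ν l⁆ ∈ Submodule.span ℂ (word bs ν '' {l' | l'.length + 1 = l.length}) := by
  induction l with
  | nil => simp [word, hν.e_zero k]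
  | cons j l ih =>
    have hf : ∀ w ∈ Submodule.span ℂ (word bs ν '' {l' | l'.length + 1 = l.length}),
        ⁅bs.f j, w⁆ ∈ Submodule.span ℂ
          (word bs ν '' {l' | l'.length + 1 = (j :: l).length}) := by
      intro w hw
      induction hw using Submodule.span_induction with
      | mem w hw =>
        obtain ⟨l', hl', rfl⟩ := hw
        refine Submodule.subset_span ⟨j :: l', ?_, rfl⟩
        simpa using hl'
      | zero => simp
      | add u v _ _ hu hv => rw [lie_add]; exact add_mem hu hv
      | smul t u _ hu => rw [lie_smul]; exact Submodule.smul_mem _ _ hu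
    rw [word, leibniz_lie]
    refine add_mem ?_ (hf _ ih)
    by_cases hkj : k = j
    · subst hkj
      rw [(bs.sl2 k).lie_e_f, hν.lie_h_word]
      exact Submodule.smul_mem _ _ (Submodule.subset_span ⟨l, by simp, rfl⟩)
    · rw [bs.lie_e_f_ne _ _ hkj, zero_lie]
      exact zero_mem _

theorem IsHighestWeight.lie_e_wordFiltration [DecidableEq ι] (hν : IsHighestWeight bs c ν)
    (k : ι) {n : ℕ} {w : W} (hw : w ∈ wordFiltration bs ν (n + 1)) :
    ⁅bs.e k, w⁆ ∈ wordFiltration bs ν n := by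
  induction hw using Submodule.span_induction with
  | mem w hw =>
    obtain ⟨l, hl, rfl⟩ := hw
    refine Submodule.span_mono ?_ (hν.lie_e_word l k)
    apply Set.image_mono
    intro l' hl'
    simp only [Set.mem_ofPred_eq] at hl hl' ⊢
    omega
  | zero => simp
  | add u v _ _ hu hv => rw [lie_add]; exact add_mem hu hv
  | smul t u _ hu => rw [lie_smul]; exact Submodule.smul_mem _ _ hu

theorem IsHighestWeight.span_word_eq_top [DecidableEq ι] (hν : IsHighestWeight bs c ν)
    (h0 : ν ≠ 0) (hirr : LieModule.IsIrreducible ℂ 𝔤 W) :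
    Submodule.span ℂ (Set.range (word bs ν)) = ⊤ := by
  set S := Submodule.span ℂ (Set.range (word bs ν)) with hS
  have hgen : ∀ x ∈ Set.range bs.e ∪ Set.range bs.f, ∀ w ∈ S, ⁅x, w⁆ ∈ S := by
    rintro x hx w hw
    induction hw using Submodule.span_induction with
    | mem w hw =>
      obtain ⟨l, rfl⟩ := hw
      rcases hx with ⟨k, rfl⟩ | ⟨k, rfl⟩
      · exact Submodule.span_mono (Set.image_subset_range _ _) (hν.lie_e_word l k)
      · exact Submodule.subset_span ⟨k :: l, rfl⟩
    | zero => simp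
    | add u v _ _ hu hv => rw [lie_add]; exact add_mem hu hv
    | smul t u _ hu => rw [lie_smul]; exact Submodule.smul_mem _ _ hu
  have hall : ∀ x ∈ LieSubalgebra.lieSpan ℂ 𝔤 (Set.range bs.e ∪ Set.range bs.f),
      ∀ w ∈ S, ⁅x, w⁆ ∈ S := by
    intro x hx
    induction hx using LieSubalgebra.lieSpan_induction with
    | mem x hx => exact hgen x hx
    | zero => simp
    | add x y _ _ hx hy => intro w hw; rw [add_lie]; exact add_mem (hx w hw) (hy w hw)
    | smul t x _ hx => intro w hw; rw [smul_lie]; exact Submodule.smul_mem _ _ (hx w hw)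
    | lie x y _ _ hx hy =>
      intro w hw
      rw [lie_lie]
      exact sub_mem (hx _ (hy w hw)) (hy _ (hx w hw))
  let N : LieSubmodule ℂ 𝔤 W :=
    { S with lie_mem := fun {x w} hw => hall x (by rw [bs.span_ef]; trivial) w hw }
  have hνN : ν ∈ N := Submodule.subset_span ⟨[], rfl⟩
  have hN : N = ⊤ := (IsSimpleOrder.eq_bot_or_eq_top N).resolve_left fun h => by
    rw [h] at hνN
    exact h0 (by simpa using hνN)
  have : N.toSubmodule = ⊤ := by rw [hN]; rfl
  exact this

theorem IsHighestWeight.exists_wordFiltration_eq_top [DecidableEq ι] [FiniteDimensional ℂ W]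
    (hν : IsHighestWeight bs c ν) (h0 : ν ≠ 0) (hirr : LieModule.IsIrreducible ℂ 𝔤 W) :
    ∃ N, wordFiltration bs ν N = ⊤ := by
  have hmono : Monotone (wordFiltration bs ν) := fun m n hmn =>
    Submodule.span_mono (Set.image_mono fun l (hl : l.length < m) => hl.trans_le hmn)
  obtain ⟨N, hN⟩ := monotone_stabilizes_iff_noetherian.2
    (inferInstance : IsNoetherian ℂ W) ⟨wordFiltration bs ν, hmono⟩
  refine ⟨N, top_le_iff.1 ?_⟩
  rw [← hν.span_word_eq_top h0 hirr, Submodule.span_le]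
  rintro _ ⟨l, rfl⟩
  have h1 : word bs ν l ∈ wordFiltration bs ν (max N (l.length + 1)) :=
    Submodule.subset_span ⟨l, by simp, rfl⟩
  have h2 := hN (max N (l.length + 1)) (le_max_left _ _)
  simp only [OrderHom.coe_mk] at h2
  rw [← h2] at h1
  exact h1

/-- The element `ρ̌ = ∑ a_k α̌_k` lowers eigenvalues by one along each `f j`, so that its eigenvalues
measure the length of words. It exists because the Cartan matrix is invertible. -/
theorem exists_lie_f_eq_neg (bs : LieAlgebra.Basis ι H) :
    ∃ a : ι → ℂ, ∀ j, ⁅∑ k, a k • bs.h k, bs.f j⁆ = -bs.f j := by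
  classical
  set Aℂ : Matrix ι ι ℂ := bs.A.map (Int.castRingHom ℂ) with hA
  have hdet : IsUnit Aℂ.det := by
    rw [hA, isUnit_iff_ne_zero]
    have := bs.nondegen.det_ne_zero
    rw [← RingHom.mapMatrix_apply, ← RingHom.map_det]
    simpa using this
  refine ⟨Aℂ⁻¹.mulVec 1, fun j => ?_⟩
  have h1 : Aℂ.mulVec (Aℂ⁻¹.mulVec 1) = 1 := by
    rw [Matrix.mulVec_mulVec, Matrix.mul_nonsing_inv _ hdet, Matrix.one_mulVec]
  have h2 : ∑ k, (bs.A j k : ℂ) * (Aℂ⁻¹.mulVec 1) k = 1 := by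
    have := congrFun h1 j
    simpa [Matrix.mulVec, dotProduct, hA] using this
  have h3 : ∀ k, ⁅(Aℂ⁻¹.mulVec 1) k • bs.h k, bs.f j⁆ =
      -(((bs.A j k : ℂ) * (Aℂ⁻¹.mulVec 1) k) • bs.f j) := by
    intro k
    rw [smul_lie, bs.lie_h_f, ← Int.cast_smul_eq_zsmul ℂ, smul_smul, ← neg_smul]
    congr 1
    push_cast; ring
  rw [sum_lie, Finset.sum_congr rfl fun k _ => h3 k, Finset.sum_neg_distrib, ← Finset.sum_smul,
    h2, one_smul]

theorem IsHighestWeight.notMem_lowerPart (hν : IsHighestWeight bs c ν) (h0 : ν ≠ 0) :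
    ν ∉ lowerPart bs ν := by
  obtain ⟨a, ha⟩ := exists_lie_f_eq_neg bs
  set d := ∑ k, a k • bs.h k with hd
  set lam : ℂ := ∑ k, a k * c k with hlam
  have hword : ∀ l : List ι, ⁅d, word bs ν l⁆ = (lam - l.length) • word bs ν l := by
    intro l
    induction l with
    | nil =>
      simp [word, hd, sum_lie, hν.weight, smul_smul, hlam, Finset.sum_smul]
    | cons j l ih =>
      rw [word, leibniz_lie, ha, ih, neg_lie, lie_smul, ← neg_one_smul ℂ, ← add_smul]
      congr 1
      simp only [List.length_cons]
      push_cast; ring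
  let T : Module.End ℂ W := LieModule.toEnd ℂ 𝔤 W d
  have h1 : ν ∈ T.eigenspace lam := by
    rw [Module.End.mem_eigenspace_iff]
    simpa [T, word] using hword []
  have h2 : lowerPart bs ν ≤ ⨆ μ, ⨆ (_ : μ ≠ lam), T.eigenspace μ := by
    rw [lowerPart, Submodule.span_le]
    rintro _ ⟨l, hl, rfl⟩
    have hne : lam - (l.length : ℂ) ≠ lam := by
      intro h
      have h' : (l.length : ℂ) = 0 := by linear_combination -h
      exact hl (List.length_eq_zero_iff.1 (by exact_mod_cast h'))
    refine Submodule.mem_iSup_of_mem (lam - (l.length : ℂ)) (Submodule.mem_iSup_of_mem hne ?_)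
    rw [Module.End.mem_eigenspace_iff]
    exact hword l
  intro hmem
  exact h0 (Submodule.disjoint_def.1 (T.eigenspaces_iSupIndep lam) ν h1 (h2 hmem))

theorem lie_f_lowerPart {x : 𝔤}
    (hx : x ∈ LieSubalgebra.lieSpan ℂ 𝔤 (Set.range bs.f)) :
    ∀ w ∈ lowerPart bs ν, ⁅x, w⁆ ∈ lowerPart bs ν := by
  induction hx using LieSubalgebra.lieSpan_induction with
  | mem x hx =>
    obtain ⟨k, rfl⟩ := hx
    intro w hw
    induction hw using Submodule.span_induction with
    | mem w hw =>
      obtain ⟨l, hl, rfl⟩ := hw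
      exact Submodule.subset_span ⟨k :: l, by simp, rfl⟩
    | zero => simp
    | add u v _ _ hu hv => rw [lie_add]; exact add_mem hu hv
    | smul t u _ hu => rw [lie_smul]; exact Submodule.smul_mem _ _ hu
  | zero => simp
  | add x y _ _ hx hy => intro w hw; rw [add_lie]; exact add_mem (hx w hw) (hy w hw)
  | smul t x _ hx => intro w hw; rw [smul_lie]; exact Submodule.smul_mem _ _ (hx w hw)
  | lie x y _ _ hx hy =>
    intro w hw
    rw [lie_lie]
    exact sub_mem (hx _ (hy w hw)) (hy _ (hx w hw))

omit [LieModule ℂ 𝔤 W] in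
theorem IsHighestWeight.lie_e_lie_f [DecidableEq ι] (hν : IsHighestWeight bs c ν) (j i : ι) :
    ⁅bs.e j, ⁅bs.f i, ν⁆⁆ = if j = i then (c i : ℂ) • ν else 0 := by
  rw [leibniz_lie, hν.e_zero, lie_zero, add_zero]
  split_ifs with h
  · subst h
    rw [(bs.sl2 j).lie_e_f, hν.weight]
  · rw [bs.lie_e_f_ne _ _ h, zero_lie]

/-- `𝔫₊` annihilates `ν` and maps `f_i ν` into the highest weight line. -/
theorem IsHighestWeight.lie_nPlus [DecidableEq ι] (hν : IsHighestWeight bs c ν) (i : ι) {x : 𝔤}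
    (hx : x ∈ LieSubalgebra.lieSpan ℂ 𝔤 (Set.range bs.e)) :
    ⁅x, ν⁆ = 0 ∧ ∃ a : ℂ, ⁅x, ⁅bs.f i, ν⁆⁆ = a • ν := by
  induction hx using LieSubalgebra.lieSpan_induction with
  | mem x hx =>
    obtain ⟨j, rfl⟩ := hx
    refine ⟨hν.e_zero j, if j = i then (c i : ℂ) else 0, ?_⟩
    rw [hν.lie_e_lie_f]
    split_ifs <;> simp
  | zero => exact ⟨by simp, 0, by simp⟩
  | add x y _ _ hx hy =>
    obtain ⟨h1, a, ha⟩ := hx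
    obtain ⟨h2, b, hb⟩ := hy
    exact ⟨by rw [add_lie, h1, h2, add_zero], a + b, by rw [add_lie, ha, hb, add_smul]⟩
  | smul t x _ hx =>
    obtain ⟨h1, a, ha⟩ := hx
    exact ⟨by rw [smul_lie, h1, smul_zero], t * a, by rw [smul_lie, ha, smul_smul]⟩
  | lie x y _ _ hx hy =>
    obtain ⟨h1, a, ha⟩ := hx
    obtain ⟨h2, b, hb⟩ := hy
    exact ⟨by rw [lie_lie, h1, h2, lie_zero, lie_zero, sub_zero], 0, by
      rw [lie_lie, ha, hb, lie_smul, lie_smul, h1, h2]; simp⟩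

theorem lie_mem_baseChange {n : Submodule ℂ 𝔤} {P Q : Submodule ℂ W}
    (h : ∀ y ∈ n, ∀ w ∈ P, ⁅y, w⁆ ∈ Q) {x : RatFn ⊗[ℂ] 𝔤} (hx : x ∈ n.baseChange RatFn)
    {w : RatFn ⊗[ℂ] W} (hw : w ∈ P.baseChange RatFn) : ⁅x, w⁆ ∈ Q.baseChange RatFn := by
  rw [Submodule.baseChange_eq_span] at hx hw
  induction hx using Submodule.span_induction with
  | mem x hx =>
    obtain ⟨y, hy, rfl⟩ := hx
    induction hw using Submodule.span_induction with
    | mem w hw =>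
      obtain ⟨v, hv, rfl⟩ := hw
      simp only [TensorProduct.mk_apply, LieAlgebra.ExtendScalars.bracket_tmul]
      exact Submodule.tmul_mem_baseChange_of_mem _ (h y hy v hv)
    | zero => simp
    | add u v _ _ hu hv => rw [lie_add]; exact add_mem hu hv
    | smul t u _ hu => rw [lie_smul]; exact Submodule.smul_mem _ _ hu
  | zero => simp
  | add u v _ _ hu hv => rw [add_lie]; exact add_mem hu hv
  | smul t u _ hu => rw [smul_lie]; exact Submodule.smul_mem _ _ hu

/-- The elements `∑ x_j e_j` act nilpotently, as the `e j` shorten words. -/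
theorem IsHighestWeight.isNilpotent_sum_e [DecidableEq ι] [FiniteDimensional ℂ W]
    (hν : IsHighestWeight bs c ν) (h0 : ν ≠ 0) (hirr : LieModule.IsIrreducible ℂ 𝔤 W)
    (x : ι → RatFn) :
    IsNilpotent (LieModule.toEnd RatFn (RatFn ⊗[ℂ] 𝔤) (RatFn ⊗[ℂ] W)
      (∑ j, x j ⊗ₜ[ℂ] bs.e j)) := by
  obtain ⟨N, hN⟩ := hν.exists_wordFiltration_eq_top h0 hirr
  set T := LieModule.toEnd RatFn (RatFn ⊗[ℂ] 𝔤) (RatFn ⊗[ℂ] W) (∑ j, x j ⊗ₜ[ℂ] bs.e j) with hT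
  have hstep : ∀ n, ∀ w ∈ (wordFiltration bs ν (n + 1)).baseChange RatFn,
      T w ∈ (wordFiltration bs ν n).baseChange RatFn := by
    intro n w hw
    refine lie_mem_baseChange (n := Submodule.span ℂ (Set.range bs.e)) ?_ ?_ hw
    · intro y hy v hv
      induction hy using Submodule.span_induction with
      | mem y hy =>
        obtain ⟨k, rfl⟩ := hy
        exact hν.lie_e_wordFiltration k hv
      | zero => simp
      | add u v _ _ hu hv => rw [add_lie]; exact add_mem hu hv
      | smul t u _ hu => rw [smul_lie]; exact Submodule.smul_mem _ _ hu
    · exact sum_mem fun j _ => Submodule.tmul_mem_baseChange_of_mem _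
        (Submodule.subset_span ⟨j, rfl⟩)
  have hpow : ∀ n, ∀ w ∈ (wordFiltration bs ν n).baseChange RatFn, (T ^ n) w = 0 := by
    intro n
    induction n with
    | zero =>
      intro w hw
      simpa [wordFiltration] using hw
    | succ n ih =>
      intro w hw
      rw [pow_succ, Module.End.mul_apply]
      exact ih _ (hstep n w hw)
  refine ⟨N, LinearMap.ext fun w => hpow N w ?_⟩
  rw [hN, Submodule.baseChange_top]
  trivial

/-- The element `∏ k, y_k ^ α̌_k` of the torus, acting on `W`. It is diagonal in a basis of weight
vectors chosen among the words. -/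
theorem IsHighestWeight.exists_torus [DecidableEq ι] (hν : IsHighestWeight bs c ν)
    (h0 : ν ≠ 0) (hirr : LieModule.IsIrreducible ℂ 𝔤 W) (y : ι → RatFnˣ) :
    ∃ t : LinearMap.GeneralLinearGroup RatFn (RatFn ⊗[ℂ] W), ∀ (v : W) (m : ι → ℤ),
      (∀ k, ⁅bs.h k, v⁆ = (m k : ℂ) • v) →
      (t : Module.End RatFn (RatFn ⊗[ℂ] W)) ((1 : RatFn) ⊗ₜ[ℂ] v) =
        ((∏ k, y k ^ m k : RatFnˣ) : RatFn) ⊗ₜ[ℂ] v := by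
  obtain ⟨b, hb, hspan, hli⟩ := exists_linearIndependent ℂ (Set.range (word bs ν))
  rw [hν.span_word_eq_top h0 hirr] at hspan
  choose l hl using fun v : b => hb v.2
  let B : Module.Basis b ℂ W := Module.Basis.mk hli (by simp [hspan])
  have hB : ∀ v, B v = (v : W) := fun v => by simp [B]
  let m' : b → ι → ℤ := fun v => wordWeight bs c (l v)
  have hm' : ∀ (v : b) k, ⁅bs.h k, (v : W)⁆ = (m' v k : ℂ) • (v : W) := by
    intro v k
    have := hν.lie_h_word (l v) k
    rwa [hl v] at this
  let BK := B.baseChange RatFn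
  let u : b → RatFnˣ := fun v => ∏ k, y k ^ m' v k
  let E := BK.equiv (BK.unitsSMul u) (Equiv.refl _)
  have hE : ∀ v : b, E ((1 : RatFn) ⊗ₜ[ℂ] (v : W)) = ((u v : RatFn)) ⊗ₜ[ℂ] (v : W) := by
    intro v
    have h1 : BK v = (1 : RatFn) ⊗ₜ[ℂ] (v : W) := by simp [BK, hB]
    have h2 : E (BK v) = BK.unitsSMul u v := by simp [E]
    rw [← h1, h2, Module.Basis.unitsSMul_apply, h1, Units.smul_def, TensorProduct.smul_tmul',
      smul_eq_mul, mul_one]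
  refine ⟨LinearMap.GeneralLinearGroup.ofLinearEquiv E, fun v m hm => ?_⟩
  -- Only basis vectors of weight `m` occur in a vector of weight `m`.
  have hcoord : ∀ a : b, B.repr v a ≠ 0 → m' a = m := by
    intro a ha
    funext k
    have hlin : ∀ w : W, B.repr ⁅bs.h k, w⁆ a = (m' a k : ℂ) * B.repr w a := by
      intro w
      let f₁ : W →ₗ[ℂ] ℂ := B.coord a ∘ₗ LieModule.toEnd ℂ 𝔤 W (bs.h k)
      let f₂ : W →ₗ[ℂ] ℂ := (m' a k : ℂ) • B.coord a
      have : f₁ = f₂ := by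
        refine B.ext fun v => ?_
        simp only [f₁, f₂, LinearMap.comp_apply, LieModule.toEnd_apply_apply, LinearMap.smul_apply,
          hB, hm', map_smul, Module.Basis.coord_apply, smul_eq_mul]
        rw [← hB v, B.repr_self]
        by_cases hva : v = a
        · rw [hva]
        · simp [hva]
      exact LinearMap.congr_fun this w
    have h1 := hlin v
    rw [hm k, map_smul, Finsupp.smul_apply, smul_eq_mul] at h1
    have := mul_right_cancel₀ ha h1
    exact_mod_cast this.symm
  change E ((1 : RatFn) ⊗ₜ[ℂ] v) = _
  have hsum := B.linearCombination_repr v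
  rw [Finsupp.linearCombination_apply, Finsupp.sum] at hsum
  rw [← hsum, TensorProduct.tmul_sum, TensorProduct.tmul_sum, map_sum]
  refine Finset.sum_congr rfl fun a ha => ?_
  have hma := hcoord a (by simpa using ha)
  rw [TensorProduct.tmul_smul, TensorProduct.tmul_smul, ← algebraMap_smul RatFn, map_smul, hB, hE,
    algebraMap_smul]
  simp only [u, hma]

end HighestWeight

/-- The off-diagonal entries of the Cartan matrix are nonpositive: `e_i` is a lowest weight vector
of weight `A i j` for the `j`-th `𝔰𝔩₂`. -/
theorem basis_A_nonpos {ι : Type*} [Fintype ι] {𝔤 : Type*} [LieRing 𝔤] [LieAlgebra ℂ 𝔤]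
    [FiniteDimensional ℂ 𝔤] {H : LieSubalgebra ℂ 𝔤} (bs : LieAlgebra.Basis ι H) {i j : ι}
    (hij : i ≠ j) : bs.A i j ≤ 0 := by
  have hp : IsSl2Triple.HasPrimitiveVectorWith (bs.sl2 j).symm (bs.e i) (-(bs.A i j : ℂ)) :=
    { ne_zero := (bs.sl2 i).e_ne_zero
      lie_h := by rw [neg_lie, bs.lie_h_e, neg_smul, Int.cast_smul_eq_zsmul]
      lie_e := by rw [← lie_skew, bs.lie_e_f_ne i j hij, neg_zero] }
  obtain ⟨n, hn⟩ := hp.exists_nat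
  have : -(bs.A i j) = (n : ℤ) := by exact_mod_cast hn
  omega

/-! ### The action of the Borel subgroups on the planes `W_i` -/

section Borel

variable {ι : Type*} [Fintype ι] [DecidableEq ι] {𝔤 : Type*} [LieRing 𝔤] [LieAlgebra ℂ 𝔤]
  {H : LieSubalgebra ℂ 𝔤} {bs : LieAlgebra.Basis ι H}
  {V : ι → Type*} [∀ i, AddCommGroup (V i)] [∀ i, Module ℂ (V i)]
  [∀ i, LieRingModule 𝔤 (V i)] [∀ i, LieModule ℂ 𝔤 (V i)] {ν : ∀ i, V i}

omit [∀ (i : ι), LieModule ℂ 𝔤 (V i)] in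
theorem IsFundamental.isHighestWeight (hV : IsFundamental bs V ν) (i : ι) :
    IsHighestWeight bs (fun j => if i = j then 1 else 0) (ν i) where
  e_zero := hV.e_zero i
  weight j := by rw [hV.weight i j]; split_ifs <;> simp

/-- The highest weight vector `ν_i` in `V_i(z)`. -/
abbrev hw (ν : ∀ i, V i) (i : ι) : RatFn ⊗[ℂ] V i := (1 : RatFn) ⊗ₜ[ℂ] ν i

/-- The vector `f_i ν_i` in `V_i(z)`. -/
abbrev fhw (bs : LieAlgebra.Basis ι H) (ν : ∀ i, V i) (i : ι) : RatFn ⊗[ℂ] V i :=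
  (1 : RatFn) ⊗ₜ[ℂ] ⁅bs.f i, ν i⁆

omit [∀ (i : ι), LieModule ℂ 𝔤 (V i)] in
theorem IsFundamental.e_lie_fhw (hV : IsFundamental bs V ν) (i j : ι) :
    ⁅bs.e j, ⁅bs.f i, ν i⁆⁆ = if j = i then ν i else 0 := by
  rw [(hV.isHighestWeight i).lie_e_lie_f]
  simp

theorem IsFundamental.h_lie_fhw (hV : IsFundamental bs V ν) (i k : ι) :
    ⁅bs.h k, ⁅bs.f i, ν i⁆⁆ =
      (((if i = k then 1 else 0) - bs.A i k : ℤ) : ℂ) • ⁅bs.f i, ν i⁆ := by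
  simpa [word, wordWeight] using (hV.isHighestWeight i).lie_h_word [i] k

omit [∀ (i : ι), LieModule ℂ 𝔤 (V i)] in
theorem IsFundamental.smul_hw_eq_zero (hV : IsFundamental bs V ν) {i : ι} {a : RatFn}
    (h : a • hw ν i = 0) : a = 0 := by
  rw [hw, TensorProduct.smul_tmul', smul_eq_mul, mul_one] at h
  obtain ⟨φ, hφ, -⟩ := Submodule.exists_le_ker_of_notMem (p := (⊥ : Submodule ℂ (V i)))
    (v := ν i) (by simpa using hV.ne_zero i)
  have h1 := congrArg (fun w => TensorProduct.rid ℂ RatFn (φ.lTensor RatFn w)) h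
  simpa [hφ] using h1

/-- `ν_i` and `f_i ν_i` are linearly independent. -/
theorem IsFundamental.smul_add_smul_eq_zero (hV : IsFundamental bs V ν) {i : ι} {a b : RatFn}
    (h : a • hw ν i + b • fhw bs ν i = 0) : a = 0 ∧ b = 0 := by
  have h1 := congrArg (fun w => ⁅((1 : RatFn) ⊗ₜ[ℂ] bs.e i), w⁆) h
  simp only [lie_add, lie_smul, LieAlgebra.ExtendScalars.bracket_tmul, hV.e_zero, hV.e_lie_fhw,
    if_true, one_mul, TensorProduct.tmul_zero, smul_zero, zero_add, lie_zero] at h1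
  have hb : b = 0 := hV.smul_hw_eq_zero h1
  subst hb
  rw [zero_smul, add_zero] at h
  exact ⟨hV.smul_hw_eq_zero h, rfl⟩

theorem IsFundamental.smul_add_smul_inj (hV : IsFundamental bs V ν) {i : ι} {a b a' b' : RatFn} :
    a • hw ν i + b • fhw bs ν i = a' • hw ν i + b' • fhw bs ν i ↔ a = a' ∧ b = b' := by
  constructor
  · intro h
    have h0 : (a - a') • hw ν i + (b - b') • fhw bs ν i = 0 := by
      rw [sub_smul, sub_smul, sub_add_sub_comm, h, sub_self]
    obtain ⟨h1, h2⟩ := hV.smul_add_smul_eq_zero h0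
    exact ⟨sub_eq_zero.1 h1, sub_eq_zero.1 h2⟩
  · rintro ⟨rfl, rfl⟩; rfl

omit [DecidableEq ι] [∀ (i : ι), LieModule ℂ 𝔤 (V i)] in
theorem mem_plane_iff {i : ι} {w : RatFn ⊗[ℂ] V i} :
    w ∈ MiuraOper.plane bs ν i ↔ ∃ a b : RatFn, w = a • hw ν i + b • fhw bs ν i := by
  rw [MiuraOper.plane, Submodule.baseChange_span, Set.image_pair, Submodule.mem_span_pair]
  simp only [TensorProduct.mk_apply, eq_comm]

variable (V) in
/-- The action of an element of the ambient group on `V_i(z)`. -/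
abbrev act (g : AmbientGL V) (i : ι) : Module.End RatFn (RatFn ⊗[ℂ] V i) := g i

omit [Fintype ι] [DecidableEq ι] in
theorem act_mul (g g' : AmbientGL V) (i : ι) (w : RatFn ⊗[ℂ] V i) :
    act V (g * g') i w = act V g i (act V g' i w) := rfl

omit [Fintype ι] [DecidableEq ι] in
theorem act_inv_act (g : AmbientGL V) (i : ι) (w : RatFn ⊗[ℂ] V i) :
    act V g⁻¹ i (act V g i w) = w := by
  rw [← act_mul, inv_mul_cancel]; rfl

omit [Fintype ι] [DecidableEq ι] in
theorem act_act_inv (g : AmbientGL V) (i : ι) (w : RatFn ⊗[ℂ] V i) :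
    act V g i (act V g⁻¹ i w) = w := by
  rw [← act_mul, mul_inv_cancel]; rfl

variable (bs ν) in
/-- `g` acts on `W_i` by an upper triangular matrix with diagonal entries `t`, `s` and
off-diagonal entry `c`, in the basis `ν_i`, `f_i ν_i`. -/
structure ActsTriangular (g : AmbientGL V) (i : ι) (t s c : RatFn) : Prop where
  t_ne : t ≠ 0
  s_ne : s ≠ 0
  act_hw : act V g i (hw ν i) = t • hw ν i
  act_fhw : act V g i (fhw bs ν i) = c • hw ν i + s • fhw bs ν i

omit [DecidableEq ι] [∀ (i : ι), LieModule ℂ 𝔤 (V i)] in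
theorem ActsTriangular.mul {g g' : AmbientGL V} {i : ι} {t s c t' s' c' : RatFn}
    (h : ActsTriangular bs ν g i t s c) (h' : ActsTriangular bs ν g' i t' s' c') :
    ActsTriangular bs ν (g * g') i (t' * t) (s' * s) (c' * t + s' * c) where
  t_ne := mul_ne_zero h'.t_ne h.t_ne
  s_ne := mul_ne_zero h'.s_ne h.s_ne
  act_hw := by rw [act_mul, h'.act_hw, map_smul, h.act_hw, smul_smul]
  act_fhw := by
    rw [act_mul, h'.act_fhw, map_add, map_smul, map_smul, h.act_hw, h.act_fhw, smul_add,
      smul_smul, smul_smul, smul_smul, add_smul, add_assoc]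

variable (bs ν) in
/-- The elements of the ambient group which act on all the planes `W_i` by upper triangular
matrices. -/
def triangular : Subgroup (AmbientGL V) where
  carrier := {g | ∀ i, ∃ t s c, ActsTriangular bs ν g i t s c}
  one_mem' i := ⟨1, 1, 0, one_ne_zero, one_ne_zero, by simp [act], by simp [act]⟩
  mul_mem' := by
    intro g g' hg hg' i
    obtain ⟨t, s, c, h⟩ := hg i
    obtain ⟨t', s', c', h'⟩ := hg' i
    exact ⟨_, _, _, h.mul h'⟩
  inv_mem' := by
    intro g hg i
    obtain ⟨t, s, c, h1, h2, h3, h4⟩ := hg i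
    have e1 : act V g⁻¹ i (hw ν i) = t⁻¹ • hw ν i := by
      have := act_inv_act g i (hw ν i)
      rw [h3, map_smul] at this
      rw [eq_inv_smul_iff₀ h1, this]
    refine ⟨t⁻¹, s⁻¹, -(s⁻¹ * c * t⁻¹), inv_ne_zero h1, inv_ne_zero h2, e1, ?_⟩
    have := act_inv_act g i (fhw bs ν i)
    rw [h4, map_add, map_smul, map_smul, e1] at this
    have h5 : s • act V g⁻¹ i (fhw bs ν i) = fhw bs ν i - c • t⁻¹ • hw ν i := by
      rw [eq_sub_iff_add_eq, add_comm, this]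
    rw [← eq_inv_smul_iff₀ h2] at h5
    rw [h5, smul_sub, smul_smul, smul_smul, neg_smul, sub_eq_neg_add]

theorem IsFundamental.triangular_of_torusSet (hV : IsFundamental bs V ν) {g : AmbientGL V}
    {y : ι → RatFnˣ} (hg : ∀ (i : ι) (v : V i) (m : ι → ℤ), (∀ k, ⁅bs.h k, v⁆ = (m k : ℂ) • v) →
    (g i : Module.End RatFn (RatFn ⊗[ℂ] V i)) ((1 : RatFn) ⊗ₜ[ℂ] v) =
      ((∏ k, y k ^ m k : RatFnˣ) : RatFn) ⊗ₜ[ℂ] v) (i : ι) :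
    ActsTriangular bs ν g i (y i) ((y i : RatFn) * ∏ k, (y k : RatFn) ^ (-bs.A i k)) 0 where
  t_ne := (y i).ne_zero
  s_ne := mul_ne_zero (y i).ne_zero
    (Finset.prod_ne_zero_iff.2 fun k _ => zpow_ne_zero _ (y k).ne_zero)
  act_hw := by
    rw [act, hw, hg i (ν i) _ (hV.isHighestWeight i).weight, TensorProduct.smul_tmul', smul_eq_mul,
      mul_one]
    congr 1
    simp
  act_fhw := by
    rw [act, fhw, hg i _ _ (hV.h_lie_fhw i), zero_smul, zero_add, TensorProduct.smul_tmul',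
      smul_eq_mul, mul_one]
    congr 1
    simp only [sub_eq_add_neg, zpow_add, Finset.prod_mul_distrib]
    simp

theorem rat_smul_apply {M : Type*} [AddCommGroup M] [Module RatFn M]
    [Module ℚ (Module.End RatFn M)] (q : ℚ) (a : Module.End RatFn M) (w : M) :
    (q • a) w = algebraMap ℚ RatFn q • a w := by
  let _ : Module ℚ M := Module.compHom M (algebraMap ℚ RatFn)
  exact map_rat_smul (LinearMap.applyₗ (R := RatFn) (M₂ := M) w) q a

theorem exp_apply_mem {M : Type*} [AddCommGroup M] [Module RatFn M] [Module ℚ (Module.End RatFn M)]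
    (a : Module.End RatFn M) {P : Submodule RatFn M} (h : ∀ w ∈ P, a w ∈ P) {w : M} (hw : w ∈ P) :
    IsNilpotent.exp a w ∈ P := by
  have hpow : ∀ n : ℕ, (a ^ n) w ∈ P := by
    intro n
    induction n with
    | zero => simpa using hw
    | succ n ih => rw [pow_succ', Module.End.mul_apply]; exact h _ ih
  rw [IsNilpotent.exp, LinearMap.sum_apply]
  refine sum_mem fun n _ => ?_
  rw [rat_smul_apply]
  exact P.smul_mem _ (hpow n)

theorem exp_apply_of_sq {M : Type*} [AddCommGroup M] [Module RatFn M]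
    [Module ℚ (Module.End RatFn M)]
    {a : Module.End RatFn M} (ha : IsNilpotent a) {w : M} (h : a (a w) = 0) :
    IsNilpotent.exp a w = w + a w := by
  obtain ⟨N, hN⟩ := ha
  have hpow : ∀ n : ℕ, (a ^ (n + 2)) w = 0 := by
    intro n
    rw [pow_add, Module.End.mul_apply, sq, Module.End.mul_apply, h, map_zero]
  rw [IsNilpotent.exp_eq_sum (k := N + 2) (by rw [pow_add, hN, zero_mul]), LinearMap.sum_apply,
    Finset.sum_congr rfl fun n _ => rat_smul_apply _ (a ^ n) w, Finset.sum_range_succ',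
    Finset.sum_range_succ', Finset.sum_eq_zero fun n _ => by rw [hpow, smul_zero]]
  simp [add_comm]

theorem IsFundamental.lie_nPlus (hV : IsFundamental bs V ν) {x : RatFn ⊗[ℂ] 𝔤}
    (hx : x ∈ nPlus bs) (i : ι) :
    ⁅x, hw ν i⁆ = 0 ∧ ∃ c : RatFn, ⁅x, fhw bs ν i⁆ = c • hw ν i := by
  rw [nPlus, Submodule.baseChange_eq_span] at hx
  induction hx using Submodule.span_induction with
  | mem x hx =>
    obtain ⟨y, hy, rfl⟩ := hx
    obtain ⟨h1, a, ha⟩ := (hV.isHighestWeight i).lie_nPlus i hy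
    refine ⟨?_, algebraMap ℂ RatFn a, ?_⟩
    · simp [hw, h1]
    · simp only [TensorProduct.mk_apply, LieAlgebra.ExtendScalars.bracket_tmul, ha, hw, mul_one,
        TensorProduct.tmul_smul, algebraMap_smul]
  | zero => exact ⟨by simp, 0, by simp⟩
  | add x y _ _ hx hy =>
    obtain ⟨h1, a, ha⟩ := hx
    obtain ⟨h2, b, hb⟩ := hy
    exact ⟨by rw [add_lie, h1, h2, add_zero], a + b, by rw [add_lie, ha, hb, add_smul]⟩
  | smul t x _ hx =>
    obtain ⟨h1, a, ha⟩ := hx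
    exact ⟨by rw [smul_lie, h1, smul_zero], t * a, by rw [smul_lie, ha, smul_smul]⟩

theorem IsFundamental.triangular_of_exp (hV : IsFundamental bs V ν) {g : AmbientGL V}
    {x : RatFn ⊗[ℂ] 𝔤} (hx : x ∈ nPlus bs) (i : ι)
    (hg : (g i : Module.End RatFn (RatFn ⊗[ℂ] V i)) =
      IsNilpotent.exp (LieModule.toEnd RatFn (RatFn ⊗[ℂ] 𝔤) (RatFn ⊗[ℂ] V i) x))
    {c : RatFn} (hc : ⁅x, fhw bs ν i⁆ = c • hw ν i) : ActsTriangular bs ν g i 1 1 c := by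
  set a := LieModule.toEnd RatFn (RatFn ⊗[ℂ] 𝔤) (RatFn ⊗[ℂ] V i) x with ha
  have h0 : ⁅x, hw ν i⁆ = 0 := (hV.lie_nPlus hx i).1
  -- `IsNilpotent.exp` is zero outside the nilpotent operators, hence not invertible there.
  have hnil : IsNilpotent a := by
    by_contra hnil
    have h1 : IsNilpotent.exp a = 0 := by
      have : nilpotencyClass a = 0 := Nat.sInf_eq_zero.2 (Or.inr
        (Set.eq_empty_iff_forall_notMem.2 fun n hn => hnil ⟨n, hn⟩))
      rw [IsNilpotent.exp, this, Finset.sum_range_zero]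
    rw [h1] at hg
    have h2 := act_inv_act g i (hw ν i)
    rw [act, act, hg] at h2
    have : (1 : RatFn) • hw ν i = 0 := by rw [one_smul, ← h2]; simp
    exact one_ne_zero (hV.smul_hw_eq_zero this)
  refine ⟨one_ne_zero, one_ne_zero, ?_, ?_⟩
  · rw [act, hg, exp_apply_of_sq hnil]
    all_goals simp [ha, h0]
  · rw [act, hg, exp_apply_of_sq hnil]
    · simp only [ha, LieModule.toEnd_apply_apply, hc, one_smul, add_comm]
    · simp only [ha, LieModule.toEnd_apply_apply, hc, lie_smul, h0, smul_zero]

theorem IsFundamental.BPlus_le_triangular (hV : IsFundamental bs V ν) :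
    BPlus bs V ≤ triangular bs ν := by
  refine sup_le ((Subgroup.closure_le _).2 ?_) ((Subgroup.closure_le _).2 ?_)
  · rintro g ⟨y, hg⟩ i
    exact ⟨_, _, _, hV.triangular_of_torusSet hg i⟩
  · rintro g ⟨x, hx, hg⟩ i
    obtain ⟨c, hc⟩ := (hV.lie_nPlus hx i).2
    exact ⟨_, _, _, hV.triangular_of_exp hx i (hg i) hc⟩

variable (bs ν) in
/-- The elements of the ambient group which preserve the span of the `f_{j₁} ⋯ f_{jₘ} ν_i` with
`0 < m`, for all `i`. -/
def lowerStabilizer : Subgroup (AmbientGL V) where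
  carrier := {g | ∀ i, ((lowerPart bs (ν i)).baseChange RatFn).map (act V g i) =
    (lowerPart bs (ν i)).baseChange RatFn}
  one_mem' i := Submodule.map_id _
  mul_mem' := by
    intro g g' hg hg' i
    have h : act V (g * g') i = act V g i ∘ₗ act V g' i := rfl
    rw [h, Submodule.map_comp, hg' i, hg i]
  inv_mem' := by
    intro g hg i
    conv_lhs => rw [← hg i]
    rw [← Submodule.map_comp]
    have : act V g⁻¹ i ∘ₗ act V g i = LinearMap.id := LinearMap.ext fun w => act_inv_act g i w
    rw [this, Submodule.map_id]

omit [DecidableEq ι] [∀ (i : ι), LieModule ℂ 𝔤 (V i)] in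
theorem mem_lowerStabilizer [∀ i, FiniteDimensional ℂ (V i)] {g : AmbientGL V}
    (h : ∀ i, ∀ w ∈ (lowerPart bs (ν i)).baseChange RatFn,
      act V g i w ∈ (lowerPart bs (ν i)).baseChange RatFn) : g ∈ lowerStabilizer bs ν := by
  intro i
  refine Submodule.eq_of_le_of_finrank_eq (Submodule.map_le_iff_le_comap.2 (h i)) ?_
  exact LinearEquiv.finrank_map_eq
    (LinearMap.GeneralLinearGroup.generalLinearEquiv RatFn _ (g i)) _

theorem IsFundamental.BMinus_le_lowerStabilizer [∀ i, FiniteDimensional ℂ (V i)]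
    (hV : IsFundamental bs V ν) : BMinus bs V ≤ lowerStabilizer bs ν := by
  refine sup_le ((Subgroup.closure_le _).2 ?_) ((Subgroup.closure_le _).2 ?_)
  · rintro g ⟨y, hg⟩
    refine mem_lowerStabilizer fun i w hw => ?_
    rw [lowerPart, Submodule.baseChange_span] at hw
    induction hw using Submodule.span_induction with
    | mem w hw =>
      obtain ⟨_, ⟨l, hl, rfl⟩, rfl⟩ := hw
      have := hg i _ _ ((hV.isHighestWeight i).lie_h_word l)
      rw [TensorProduct.mk_apply, act, this]
      exact Submodule.tmul_mem_baseChange_of_mem _ (Submodule.subset_span ⟨l, hl, rfl⟩)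
    | zero => simp
    | add u v _ _ hu hv => rw [map_add]; exact add_mem hu hv
    | smul t u _ hu => rw [map_smul]; exact Submodule.smul_mem _ _ hu
  · rintro g ⟨x, hx, hg⟩
    refine mem_lowerStabilizer fun i w hw => ?_
    rw [act, hg i]
    exact exp_apply_mem _ (fun w hw => lie_mem_baseChange
      (fun y hy v hv => lie_f_lowerPart hy v hv) hx hw) hw

/-- An element of `B₊(z) ∩ B₋(z)` acts on the planes `W_i` by diagonal matrices. -/
theorem IsFundamental.off_diagonal_eq_zero (hV : IsFundamental bs V ν) {g : AmbientGL V}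
    (hg : g ∈ lowerStabilizer bs ν) {i : ι} {t s c : RatFn} (h : ActsTriangular bs ν g i t s c) :
    c = 0 := by
  have hf : fhw bs ν i ∈ (lowerPart bs (ν i)).baseChange RatFn :=
    Submodule.tmul_mem_baseChange_of_mem _ (Submodule.subset_span ⟨[i], by simp, rfl⟩)
  have h1 : act V g i (fhw bs ν i) ∈ (lowerPart bs (ν i)).baseChange RatFn := by
    rw [← hg i]
    exact Submodule.mem_map_of_mem hf
  rw [h.act_fhw] at h1
  have h2 : c • hw ν i ∈ (lowerPart bs (ν i)).baseChange RatFn := by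
    have := sub_mem h1 (Submodule.smul_mem _ s hf)
    rwa [add_sub_cancel_right] at this
  -- A functional that vanishes on the lower part but not at `ν i` reads off `c`.
  obtain ⟨φ, hφ, hle⟩ := Submodule.exists_le_ker_of_notMem
    ((hV.isHighestWeight i).notMem_lowerPart (hV.ne_zero i))
  have h3 : ∀ w ∈ (lowerPart bs (ν i)).baseChange RatFn, φ.baseChange RatFn w = 0 := by
    intro w hw
    rw [Submodule.baseChange_eq_span] at hw
    induction hw using Submodule.span_induction with
    | mem w hw =>
      obtain ⟨v, hv, rfl⟩ := hw
      simp [LinearMap.mem_ker.1 (hle hv)]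
    | zero => simp
    | add u v _ _ hu hv => rw [map_add, hu, hv, add_zero]
    | smul t u _ hu => rw [map_smul, hu, smul_zero]
  have h4 := congrArg (TensorProduct.AlgebraTensorModule.rid ℂ RatFn RatFn) (h3 _ h2)
  simpa [hφ] using h4

end Borel

/-! ### Connections of Miura form on the planes `W_i` -/

section Connections

variable {ι : Type*} [Fintype ι] [DecidableEq ι] {𝔤 : Type*} [LieRing 𝔤] [LieAlgebra ℂ 𝔤]
  {H : LieSubalgebra ℂ 𝔤} {bs : LieAlgebra.Basis ι H}
  {V : ι → Type*} [∀ i, AddCommGroup (V i)] [∀ i, Module ℂ (V i)]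
  [∀ i, LieRingModule 𝔤 (V i)] [∀ i, LieModule ℂ 𝔤 (V i)] {ν : ∀ i, V i}

omit [Fintype ι] [DecidableEq ι] in
theorem nabla_smul (A : RatFn ⊗[ℂ] 𝔤) (i : ι) (f : RatFn) (w : RatFn ⊗[ℂ] V i) :
    nabla V A i (f • w) = dz f • w + f • nabla V A i w := by
  have h : (LinearMap.rTensor (V i) (dz : RatFn →ₗ[ℂ] RatFn)) (f • w) =
      dz f • w + f • (LinearMap.rTensor (V i) (dz : RatFn →ₗ[ℂ] RatFn)) w := by
    induction w using TensorProduct.induction_on with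
    | zero => simp
    | add u v hu hv => rw [smul_add, map_add, hu, hv, map_add, smul_add, smul_add]; abel
    | tmul a v =>
      simp only [TensorProduct.smul_tmul', smul_eq_mul, LinearMap.rTensor_tmul]
      rw [← TensorProduct.add_tmul]
      congr 1
      change dz (f * a) = _
      rw [dz_mul, add_comm, mul_comm a]
      rfl
  simp only [nabla, LinearMap.add_apply, LinearMap.restrictScalars_apply, map_smul, h, smul_add]
  abel

omit [Fintype ι] [DecidableEq ι] in
theorem nabla_one_tmul (A : RatFn ⊗[ℂ] 𝔤) (i : ι) (v : V i) :
    nabla V A i ((1 : RatFn) ⊗ₜ[ℂ] v) = ⁅A, (1 : RatFn) ⊗ₜ[ℂ] v⁆ := by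
  have h : dz (1 : RatFn) = 0 := dz.map_one_eq_zero
  simp only [nabla, LinearMap.add_apply, LinearMap.rTensor_tmul, LinearMap.restrictScalars_apply,
    LieModule.toEnd_apply_apply]
  change dz (1 : RatFn) ⊗ₜ[ℂ] v + _ = _
  rw [h, TensorProduct.zero_tmul, zero_add]

theorem IsFundamental.miuraMatrix_lie_hw (hV : IsFundamental bs V ν) (g φ : ι → RatFn) (i : ι) :
    ⁅miuraMatrix bs g φ, hw ν i⁆ = g i • hw ν i := by
  simp only [miuraMatrix, hw, add_lie, sum_lie, LieAlgebra.ExtendScalars.bracket_tmul, hV.e_zero,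
    hV.weight, TensorProduct.tmul_zero, Finset.sum_const_zero, add_zero, mul_one,
    TensorProduct.smul_tmul', smul_eq_mul]
  rw [Finset.sum_eq_single i]
  · simp
  · intro j _ hj
    rw [if_neg (Ne.symm hj), TensorProduct.tmul_zero]
  · simp

theorem IsFundamental.miuraMatrix_lie_fhw (hV : IsFundamental bs V ν) (g φ : ι → RatFn) (i : ι) :
    ⁅miuraMatrix bs g φ, fhw bs ν i⁆ =
      φ i • hw ν i + (g i - ∑ k, (bs.A i k : RatFn) * g k) • fhw bs ν i := by
  have h1 : ∀ k, ⁅g k ⊗ₜ[ℂ] bs.h k, fhw bs ν i⁆ =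
      ((if i = k then g k else 0) - (bs.A i k : RatFn) * g k) • fhw bs ν i := by
    intro k
    rw [fhw, LieAlgebra.ExtendScalars.bracket_tmul, hV.h_lie_fhw, mul_one,
      TensorProduct.tmul_smul, TensorProduct.smul_tmul', TensorProduct.smul_tmul', smul_eq_mul,
      mul_one, Int.cast_smul_eq_zsmul, sub_smul, zsmul_eq_mul]
    congr 1
    split_ifs <;> simp
  have h2 : ∀ k, ⁅φ k ⊗ₜ[ℂ] bs.e k, fhw bs ν i⁆ = if k = i then φ i • hw ν i else 0 := by
    intro k
    rw [fhw, LieAlgebra.ExtendScalars.bracket_tmul, hV.e_lie_fhw, mul_one]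
    split_ifs with h
    · rw [h, TensorProduct.smul_tmul', smul_eq_mul, mul_one]
    · rw [TensorProduct.tmul_zero]
  rw [miuraMatrix, add_lie, sum_lie, sum_lie, Finset.sum_congr rfl fun k _ => h1 k,
    Finset.sum_congr rfl fun k _ => h2 k, ← Finset.sum_smul, Finset.sum_sub_distrib, add_comm]
  simp

omit [DecidableEq ι] in
theorem const_ZH (ζ : ι → ℂ) :
    const (ZH bs ζ) = miuraMatrix bs (fun i => ofPoly (C (ζ i))) fun _ => 0 := by
  simp only [const, ZH, miuraMatrix, TensorProduct.tmul_sum, TensorProduct.zero_tmul,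
    Finset.sum_const_zero, add_zero]
  refine Finset.sum_congr rfl fun i _ => ?_
  rw [TensorProduct.tmul_smul, TensorProduct.smul_tmul', Algebra.smul_def, mul_one]
  rfl

omit [DecidableEq ι] in
theorem sum_A_mul_C (ζ : ι → ℂ) (i : ι) :
    ∑ k, (bs.A i k : RatFn) * ofPoly (C (ζ k)) = ofPoly (C (rootZH bs ζ i)) := by
  simp only [rootZH, cartan, ofPoly, map_sum, map_mul]
  refine Finset.sum_congr rfl fun k _ => ?_
  simp

/-- An upper triangular element intertwines two connections of Miura form on `W_i` exactly when its
entries satisfy three differential equations. -/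
theorem IsFundamental.intertwines_iff (hV : IsFundamental bs V ν) {v : AmbientGL V} {i : ι}
    {t s c : RatFn} (h : ActsTriangular bs ν v i t s c) (g φ g' φ' : ι → RatFn) :
    (∀ w ∈ MiuraOper.plane bs ν i, nabla V (miuraMatrix bs g' φ') i (act V v i w) =
        act V v i (nabla V (miuraMatrix bs g φ) i w)) ↔
      dz t + t * g' i = t * g i ∧
      dz s + s * (g' i - ∑ k, (bs.A i k : RatFn) * g' k) =
        s * (g i - ∑ k, (bs.A i k : RatFn) * g k) ∧
      dz c + c * g' i + s * φ' i = c * (g i - ∑ k, (bs.A i k : RatFn) * g k) + t * φ i := by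
  set a := g i - ∑ k, (bs.A i k : RatFn) * g k
  set a' := g' i - ∑ k, (bs.A i k : RatFn) * g' k
  have n1 : ∀ g φ, nabla V (miuraMatrix bs g φ) i (hw ν i) = g i • hw ν i := fun g φ => by
    rw [hw, nabla_one_tmul, hV.miuraMatrix_lie_hw]
  have n2 : ∀ g φ, nabla V (miuraMatrix bs g φ) i (fhw bs ν i) =
      φ i • hw ν i + (g i - ∑ k, (bs.A i k : RatFn) * g k) • fhw bs ν i := fun g φ => by
    rw [fhw, nabla_one_tmul, hV.miuraMatrix_lie_fhw]
  have l1 : nabla V (miuraMatrix bs g' φ') i (act V v i (hw ν i)) =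
      (dz t + t * g' i) • hw ν i := by
    rw [h.act_hw, nabla_smul, n1, smul_smul, add_smul]
  have r1 : act V v i (nabla V (miuraMatrix bs g φ) i (hw ν i)) = (t * g i) • hw ν i := by
    rw [n1, map_smul, h.act_hw, smul_smul, mul_comm]
  have l2 : nabla V (miuraMatrix bs g' φ') i (act V v i (fhw bs ν i)) =
      (dz c + c * g' i + s * φ' i) • hw ν i + (dz s + s * a') • fhw bs ν i := by
    rw [h.act_fhw, map_add, nabla_smul, nabla_smul, n1, n2]
    simp only [smul_add, smul_smul, add_smul]
    abel
  have r2 : act V v i (nabla V (miuraMatrix bs g φ) i (fhw bs ν i)) =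
      (c * a + t * φ i) • hw ν i + (s * a) • fhw bs ν i := by
    rw [n2, map_add, map_smul, map_smul, h.act_hw, h.act_fhw]
    simp only [smul_add, smul_smul, add_smul, mul_comm _ c, mul_comm _ s, mul_comm _ t]
    abel
  constructor
  · intro hw'
    have e1 := hw' (hw ν i) (mem_plane_iff.2 ⟨1, 0, by simp⟩)
    have e2 := hw' (fhw bs ν i) (mem_plane_iff.2 ⟨0, 1, by simp⟩)
    rw [l1, r1] at e1
    rw [l2, r2, hV.smul_add_smul_inj] at e2
    refine ⟨?_, e2.2, e2.1⟩
    rw [← sub_eq_zero]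
    apply hV.smul_hw_eq_zero (i := i)
    rw [sub_smul, e1, sub_self]
  · rintro ⟨e1, e2, e3⟩ w hw'
    obtain ⟨x, y, rfl⟩ := mem_plane_iff.1 hw'
    have k1 : nabla V (miuraMatrix bs g' φ') i (act V v i (hw ν i)) =
        act V v i (nabla V (miuraMatrix bs g φ) i (hw ν i)) := by rw [l1, r1, e1]
    have k2 : nabla V (miuraMatrix bs g' φ') i (act V v i (fhw bs ν i)) =
        act V v i (nabla V (miuraMatrix bs g φ) i (fhw bs ν i)) := by rw [l2, r2, e2, e3]
    simp only [map_add, map_smul, nabla_smul, k1, k2]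

omit [DecidableEq ι] [∀ (i : ι), LieModule ℂ 𝔤 (V i)] in
theorem act_mem_plane {v : AmbientGL V} (hv : v ∈ triangular bs ν) {i : ι}
    {w : RatFn ⊗[ℂ] V i} (hw' : w ∈ MiuraOper.plane bs ν i) :
    act V v i w ∈ MiuraOper.plane bs ν i := by
  obtain ⟨x, y, rfl⟩ := mem_plane_iff.1 hw'
  obtain ⟨t, s, c, h⟩ := hv i
  refine mem_plane_iff.2 ⟨x * t + y * c, y * s, ?_⟩
  rw [map_add, map_smul, map_smul, h.act_hw, h.act_fhw]
  simp only [smul_add, smul_smul, add_smul, add_assoc]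

omit [DecidableEq ι] in
theorem A_diag : ∀ i, bs.A i i = 2 := by
  have : IsAddTorsionFree 𝔤 := IsAddTorsionFree.of_isTorsionFree ℂ 𝔤
  exact bs.A_diag_eq_two

theorem prod_zpow_cartan {y : ι → RatFn} (i : ι) :
    ∏ k, y k ^ (-cartan bs k i) =
      (∏ k ∈ Finset.univ.erase i, y k ^ (-cartan bs k i)) * y i ^ (-2 : ℤ) := by
  rw [← Finset.prod_erase_mul _ _ (Finset.mem_univ i)]
  congr 2
  rw [cartan, A_diag]

omit [DecidableEq ι] in
theorem dlog_diagonal {y : ι → RatFn} (hy : ∀ i, y i ≠ 0) (i : ι) :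
    dz (y i * ∏ k, y k ^ (-bs.A i k)) / (y i * ∏ k, y k ^ (-bs.A i k)) =
      dz (y i) / y i - ∑ k, (bs.A i k : RatFn) * (dz (y k) / y k) := by
  rw [dlog_mul (hy i) (Finset.prod_ne_zero_iff.2 fun k _ => zpow_ne_zero _ (hy k)),
    dlog_prod _ _ fun k _ => zpow_ne_zero _ (hy k), sub_eq_add_neg, ← Finset.sum_neg_distrib]
  congr 1
  refine Finset.sum_congr rfl fun k _ => ?_
  rw [dlog_zpow (hy k)]
  push_cast; ring

/-- The off-diagonal equation for an element intertwining `∂_z + Z^H` with the connection attached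
to `y` is the `i`-th equation of the `qq`-system. -/
theorem off_diagonal_iff {y φ : ι → RatFn} {ζ : ι → ℂ} (hy : ∀ i, y i ≠ 0) (i : ι) {κ f : RatFn} :
    dz (-f) + -f * (ofPoly (C (ζ i)) - dz (y i) / y i) +
        κ * (y i * ∏ k, y k ^ (-bs.A i k)) * φ i =
      -f * (ofPoly (C (ζ i)) - ofPoly (C (rootZH bs ζ i))) ↔
    y i * dz f - f * dz (y i) + ofPoly (C (rootZH bs ζ i)) * y i * f =
      κ * (φ i * ∏ k ∈ Finset.univ.erase i, y k ^ (-cartan bs k i)) := by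
  have hyi := hy i
  have h := prod_zpow_cartan (bs := bs) (y := y) i
  simp only [cartan] at h ⊢
  rw [h, map_neg, zpow_neg, zpow_ofNat]
  generalize (∏ k ∈ Finset.univ.erase i, y k ^ (-bs.A i k)) = P
  constructor
  · intro e
    field_simp at e
    linear_combination -e
  · intro e
    field_simp
    linear_combination -e

end Connections

section Solutions

variable {ι : Type*} [Fintype ι] [DecidableEq ι] {𝔤 : Type*} [LieRing 𝔤] [LieAlgebra ℂ 𝔤]
  {H : LieSubalgebra ℂ 𝔤} {bs : LieAlgebra.Basis ι H}

/-! ### The `qq`-system and the Bethe Ansatz equations -/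

variable (bs) in
/-- The polynomial `ρ_i = L_i ∏_{j ≠ i} q_j ^ (-a_{ji})`; the exponents are natural numbers as the
off-diagonal Cartan integers are nonpositive. -/
def rhsPoly (L q : ι → ℂ[X]) (i : ι) : ℂ[X] :=
  L i * ∏ j ∈ Finset.univ.erase i, q j ^ (-cartan bs j i).toNat

theorem ofPoly_rhsPoly [FiniteDimensional ℂ 𝔤] (L q : ι → ℂ[X]) (i : ι) :
    ofPoly (rhsPoly bs L q i) =
      ofPoly (L i) * ∏ j ∈ Finset.univ.erase i, ofPoly (q j) ^ (-cartan bs j i) := by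
  simp only [rhsPoly, ofPoly, map_mul, map_prod, map_pow]
  congr 1
  refine Finset.prod_congr rfl fun j hj => ?_
  have h : 0 ≤ -cartan bs j i := by
    have := basis_A_nonpos bs (Finset.ne_of_mem_erase hj).symm
    simpa [cartan] using this
  rw [← zpow_natCast, Int.toNat_of_nonneg h]

theorem eval_rhsPoly_ne_zero {L q : ι → ℂ[X]} {i : ι} {w : ℂ} (hL : ¬ (L i).IsRoot w)
    (hq : ∀ j, j ≠ i → cartan bs j i ≠ 0 → ¬ (q j).IsRoot w) :
    (rhsPoly bs L q i).eval w ≠ 0 := by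
  rw [rhsPoly, eval_mul, eval_prod]
  refine mul_ne_zero hL (Finset.prod_ne_zero_iff.2 fun j hj => ?_)
  rw [eval_pow]
  by_cases h : cartan bs j i = 0
  · simp [h]
  · exact pow_ne_zero _ (hq j (Finset.ne_of_mem_erase hj) h)

theorem prod_X_sub_C_roots_toFinset {q : ℂ[X]} (hm : q.Monic)
    (hs : ∀ w, q.rootMultiplicity w ≤ 1) : ∏ s ∈ q.roots.toFinset, (X - C s) = q := by
  have hn : q.roots.Nodup := Multiset.nodup_iff_count_le_one.2 fun w => by
    rw [count_roots]; exact hs w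
  conv_rhs => rw [(IsAlgClosed.splits q).eq_prod_roots_of_monic hm]
  rw [Finset.prod_eq_multiset_prod, Multiset.toFinset_val, hn.dedup]

theorem roots_prod_X_sub_C_toFinset (S : Finset ℂ) :
    (∏ s ∈ S, (X - C s)).roots.toFinset = S := by
  rw [roots_prod_X_sub_C, Finset.val_toFinset]

variable {ζ : ι → ℂ} {L : ι → ℂ[X]}

theorem NondegQQSolution.wronskian_eq [FiniteDimensional ℂ 𝔤] (q : NondegQQSolution bs ζ L)
    (i : ι) :
    q.qPlus i * derivative (q.qMinus i) - q.qMinus i * derivative (q.qPlus i) +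
      C (rootZH bs ζ i) * q.qPlus i * q.qMinus i = rhsPoly bs L q.qPlus i := by
  apply ofPoly_injective
  rw [q.eqn i, ofPoly_rhsPoly]

/-- At `w` the logarithmic derivative in the Bethe Ansatz equations is
`ρ_i' / ρ_i - q_i'' / q_i'`. -/
theorem bethe_eqn_iff [FiniteDimensional ℂ 𝔤] {Q : ι → ℂ[X]} {i : ι} {w : ℂ}
    (hw : (Q i).eval w = 0) (hw' : (derivative (Q i)).eval w ≠ 0)
    (hρ : (rhsPoly bs L Q i).eval w ≠ 0) {F : RatFn}
    (hF : F = ofPoly (L i) * (∏ j, ofPoly (Q j) ^ (-cartan bs j i)) * ofPoly ((X - C w) ^ 2)) :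
    rootZH bs ζ i + RatFunc.eval (RingHom.id ℂ) w (dz F / F) = 0 ↔
      (rootZH bs ζ i * (rhsPoly bs L Q i).eval w + (derivative (rhsPoly bs L Q i)).eval w) *
          (derivative (Q i)).eval w =
        (rhsPoly bs L Q i).eval w * (derivative (derivative (Q i))).eval w := by
  rw [prod_zpow_cartan, ← mul_assoc, ← ofPoly_rhsPoly] at hF
  rw [eval_dlog_bethe hw hw' hρ hF]
  constructor
  · intro h
    field_simp at h
    linear_combination h
  · intro h
    field_simp
    linear_combination h

/-- The roots of the polynomials `q₊^i` solve the Bethe Ansatz equations. -/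
def NondegQQSolution.toBethe [FiniteDimensional ℂ 𝔤] (q : NondegQQSolution bs ζ L) :
    BetheSolution bs ζ L where
  roots i := (q.qPlus i).roots.toFinset
  not_root i w hw h := by
    obtain ⟨-, -, h3, -⟩ := (yNondegenerate_ofPoly_iff _ _ _).1 q.nondeg
    exact h3 i w h (isRoot_of_mem_roots (Multiset.mem_toFinset.1 hw))
  ne i j hij ha := by
    obtain ⟨-, -, -, h4⟩ := (yNondegenerate_ofPoly_iff _ _ _).1 q.nondeg
    refine Finset.disjoint_left.2 fun w hi hj => h4 j i w hij.symm ha ?_ ?_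
    · exact isRoot_of_mem_roots (Multiset.mem_toFinset.1 hj)
    · exact isRoot_of_mem_roots (Multiset.mem_toFinset.1 hi)
  eqn i w hw F hF := by
    obtain ⟨h1, h2, h3, h4⟩ := (yNondegenerate_ofPoly_iff _ _ _).1 q.nondeg
    have hr : (q.qPlus i).IsRoot w := isRoot_of_mem_roots (Multiset.mem_toFinset.1 hw)
    simp only [prod_X_sub_C_roots_toFinset (q.monic _) (h2 _)] at hF
    rw [bethe_eqn_iff hr (derivative_eval_ne_zero (h1 i) (h2 i w) hr)
      (eval_rhsPoly_ne_zero (fun h => h3 i w h hr) fun j hj ha h => h4 j i w hj ha h hr) hF]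
    exact bethe_of_wronskian_eq (q.wronskian_eq i) hr

theorem NondegQQSolution.toBethe_eq_iff [FiniteDimensional ℂ 𝔤] (q q' : NondegQQSolution bs ζ L) :
    q.toBethe = q'.toBethe ↔ q.qPlus = q'.qPlus := by
  have h2 := fun q : NondegQQSolution bs ζ L => ((yNondegenerate_ofPoly_iff _ _ _).1 q.nondeg).2.1
  constructor
  · intro h
    funext i
    have hi : (q.qPlus i).roots.toFinset = (q'.qPlus i).roots.toFinset :=
      congrFun (congrArg BetheSolution.roots h) i
    rw [← prod_X_sub_C_roots_toFinset (q.monic i) (h2 q i), hi,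
      prod_X_sub_C_roots_toFinset (q'.monic i) (h2 q' i)]
  · intro h
    ext i : 2
    change (q.qPlus i).roots.toFinset = (q'.qPlus i).roots.toFinset
    rw [h]

theorem NondegQQSolution.toBethe_surjective [FiniteDimensional ℂ 𝔤] :
    Function.Surjective (NondegQQSolution.toBethe (bs := bs) (ζ := ζ) (L := L)) := by
  intro b
  let Q : ι → ℂ[X] := fun i => ∏ s ∈ b.roots i, (X - C s)
  have hroot : ∀ i w, (Q i).IsRoot w ↔ w ∈ b.roots i := fun i w =>
    eval_prod_X_sub_C_eq_zero_iff
  have hne : ∀ i, Q i ≠ 0 := fun i => (prod_X_sub_C_monic _).ne_zero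
  have hsimple : ∀ i w, (Q i).rootMultiplicity w ≤ 1 := fun i w =>
    rootMultiplicity_prod_X_sub_C_le _ w
  have hex : ∀ i, ∃ f : ℂ[X], Q i * derivative f - f * derivative (Q i) +
      C (rootZH bs ζ i) * Q i * f = rhsPoly bs L Q i := by
    intro i
    refine exists_wronskian_eq rfl fun w hw => ?_
    have hr := (hroot i w).2 hw
    refine (bethe_eqn_iff hr (derivative_eval_ne_zero (hne i) (hsimple i w) hr)
      (eval_rhsPoly_ne_zero (b.not_root i w hw) fun j hj ha h => ?_) rfl).1 (b.eqn i w hw _ rfl)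
    exact Finset.disjoint_left.1 (b.ne i j hj.symm ha) hw ((hroot j w).1 h)
  choose f hf using hex
  refine ⟨⟨Q, f, fun i => ?_, fun i => prod_X_sub_C_monic _, ?_⟩, ?_⟩
  · rw [hf i, ofPoly_rhsPoly]
  · refine (yNondegenerate_ofPoly_iff _ _ _).2 ⟨hne, hsimple, fun i w hL h => ?_,
      fun i j w hij ha hi hj => ?_⟩
    · exact b.not_root i w ((hroot i w).1 h) hL
    · exact Finset.disjoint_left.1 (b.ne j i hij.symm ha) ((hroot j w).1 hj) ((hroot i w).1 hi)
  · ext i : 2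
    exact roots_prod_X_sub_C_toFinset (b.roots i)

/-! ### The oper attached to a solution -/

variable {V : ι → Type*} [∀ i, AddCommGroup (V i)] [∀ i, Module ℂ (V i)]
  [∀ i, LieRingModule 𝔤 (V i)] [∀ i, LieModule ℂ 𝔤 (V i)] {ν : ∀ i, V i}

omit [DecidableEq ι] in
theorem sum_h_mem_bMinus (g : ι → RatFn) : ∑ i, g i ⊗ₜ[ℂ] bs.h i ∈ bMinus bs :=
  sum_mem fun i _ => Submodule.tmul_mem_baseChange_of_mem _
    (LieSubalgebra.subset_lieSpan (Or.inr ⟨i, rfl⟩))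

omit [DecidableEq ι] in
theorem miuraMatrix_mem_bPlus (g φ : ι → RatFn) : miuraMatrix bs g φ ∈ bPlus bs :=
  add_mem
    (sum_mem fun i _ => Submodule.tmul_mem_baseChange_of_mem _
      (LieSubalgebra.subset_lieSpan (Or.inr ⟨i, rfl⟩)))
    (sum_mem fun i _ => Submodule.tmul_mem_baseChange_of_mem _
      (LieSubalgebra.subset_lieSpan (Or.inl ⟨i, rfl⟩)))

variable (bs V) in
/-- The Miura oper `∂_z + ∑ g_i α̌_i + ∑ φ_i e_i` with the standard reductions. -/
def standardOper (g φ : ι → RatFn) (hφ : ∀ i, φ i ≠ 0) : MiuraOper bs V where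
  conn := miuraMatrix bs g φ
  redMinus := 1
  redPlus := 1
  redMinus_mem := one_mem _
  redPlus_mem := one_mem _
  oper := ⟨φ, hφ, _, sum_h_mem_bMinus g, by
    rw [inv_one, add_comm]; exact IsGauge.one _⟩
  preserved := ⟨_, miuraMatrix_mem_bPlus g φ, by rw [inv_one]; exact IsGauge.one _⟩

/-- The coefficients `ζ_i - y_i' / y_i` of the Cartan connection. -/
def cartanCoeff (ζ : ι → ℂ) (y : ι → RatFn) (i : ι) : RatFn :=
  ofPoly (C (ζ i)) - dz (y i) / y i

/-- An element of `B₊(z)` with prescribed torus part and prescribed off-diagonal entries. -/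
theorem IsFundamental.exists_mem_BPlus [∀ i, FiniteDimensional ℂ (V i)]
    (hV : IsFundamental bs V ν) {y : ι → RatFn} (hy : ∀ i, y i ≠ 0) (c : ι → RatFn) :
    ∃ v ∈ BPlus bs V, ∀ i,
      ActsTriangular bs ν v i (y i) (y i * ∏ k, y k ^ (-bs.A i k)) (c i) := by
  choose t ht using fun i => (hV.isHighestWeight i).exists_torus (hV.ne_zero i) (hV.irreducible i)
    fun k => Units.mk0 (y k) (hy k)
  set x : RatFn ⊗[ℂ] 𝔤 := ∑ j, (c j / y j) ⊗ₜ[ℂ] bs.e j with hx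
  have hxn : x ∈ nPlus bs := sum_mem fun i _ => Submodule.tmul_mem_baseChange_of_mem _
    (LieSubalgebra.subset_lieSpan ⟨i, rfl⟩)
  have hunit : ∀ i, IsUnit (IsNilpotent.exp
      (LieModule.toEnd RatFn (RatFn ⊗[ℂ] 𝔤) (RatFn ⊗[ℂ] V i) x)) := fun i =>
    IsNilpotent.isUnit_exp
      ((hV.isHighestWeight i).isNilpotent_sum_e (hV.ne_zero i) (hV.irreducible i) _)
  let u : AmbientGL V := fun i => (hunit i).unit
  have htm : t ∈ torusSet bs V := ⟨_, ht⟩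
  have hum : u ∈ expSet V (nPlus bs) := ⟨x, hxn, fun i => rfl⟩
  have hxf : ∀ i, ⁅x, fhw bs ν i⁆ = (c i / y i) • hw ν i := by
    intro i
    have := hV.miuraMatrix_lie_fhw (fun _ => 0) (fun j => c j / y j) i
    simpa [miuraMatrix, hx] using this
  refine ⟨t * u, mul_mem (Subgroup.mem_sup_left (Subgroup.subset_closure htm))
    (Subgroup.mem_sup_right (Subgroup.subset_closure hum)), fun i => ?_⟩
  have h1 := hV.triangular_of_torusSet ht i
  have h2 : ActsTriangular bs ν u i 1 1 (c i / y i) :=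
    hV.triangular_of_exp hxn i rfl (hxf i)
  have := h1.mul h2
  simpa [div_mul_cancel₀ _ (hy i)] using this

omit [DecidableEq ι] in
theorem cartanCoeff_sub_sum (ζ : ι → ℂ) (y : ι → RatFn) (i : ι) :
    cartanCoeff ζ y i - ∑ k, (bs.A i k : RatFn) * cartanCoeff ζ y k =
      ofPoly (C (ζ i)) - ofPoly (C (rootZH bs ζ i)) -
        (dz (y i) / y i - ∑ k, (bs.A i k : RatFn) * (dz (y k) / y k)) := by
  simp only [cartanCoeff, mul_sub, Finset.sum_sub_distrib, sum_A_mul_C]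
  ring

/-- If the `qq`-system is solvable, the standard oper is `Z^H`-twisted Miura–Plücker. -/
theorem IsFundamental.isTwistedMiuraPlucker_standardOper [∀ i, FiniteDimensional ℂ (V i)]
    (hV : IsFundamental bs V ν) {y φ f : ι → RatFn} (hy : ∀ i, y i ≠ 0) (hφ : ∀ i, φ i ≠ 0)
    (hf : ∀ i, y i * dz (f i) - f i * dz (y i) + ofPoly (C (rootZH bs ζ i)) * y i * f i =
      φ i * ∏ k ∈ Finset.univ.erase i, y k ^ (-cartan bs k i)) :
    (standardOper bs V (cartanCoeff ζ y) φ hφ).IsTwistedMiuraPlucker ν (ZH bs ζ) := by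
  obtain ⟨v, hv, htri⟩ := hV.exists_mem_BPlus hy fun i => -f i
  refine ⟨miuraMatrix bs (cartanCoeff ζ y) φ, miuraMatrix_mem_bPlus _ _, ?_, v, hv,
    fun i w hw' => ?_⟩
  · rw [standardOper, inv_one]; exact IsGauge.one _
  have key := (hV.intertwines_iff (htri i) (fun i => ofPoly (C (ζ i))) (fun _ => 0)
    (cartanCoeff ζ y) φ).2 ⟨?_, ?_, ?_⟩ (act V v⁻¹ i w)
    (act_mem_plane (inv_mem (hV.BPlus_le_triangular hv)) hw')
  · rw [act_act_inv] at key
    rw [const_ZH]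
    exact key
  · have := hy i
    rw [cartanCoeff]
    field_simp
    ring
  · have hd := dlog_diagonal (bs := bs) hy i
    rw [div_eq_iff (htri i).s_ne] at hd
    rw [hd, cartanCoeff_sub_sum, sum_A_mul_C]
    ring
  · have := (off_diagonal_iff (bs := bs) (ζ := ζ) (φ := φ) hy i (κ := 1) (f := f i)).2
      (by rw [one_mul]; exact hf i)
    rw [one_mul] at this
    rw [sum_A_mul_C, mul_zero, add_zero]
    exact this

/-- Conversely, if the connections on the planes are intertwined with `∂_z + Z^H`, then the
`qq`-system is solvable in rational functions. -/
theorem IsFundamental.exists_rational_solution (hV : IsFundamental bs V ν) {y φ : ι → RatFn}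
    (hy : ∀ i, y i ≠ 0) {v : AmbientGL V} (hv : v ∈ triangular bs ν)
    (h : ∀ i, ∀ w ∈ MiuraOper.plane bs ν i,
      nabla V (miuraMatrix bs (cartanCoeff ζ y) φ) i (act V v i w) =
        act V v i (nabla V (const (ZH bs ζ)) i w)) (i : ι) :
    ∃ f : RatFn, y i * dz f - f * dz (y i) + ofPoly (C (rootZH bs ζ i)) * y i * f =
      φ i * ∏ k ∈ Finset.univ.erase i, y k ^ (-cartan bs k i) := by
  obtain ⟨t, s, c, htri⟩ := hv i
  have hi := h i
  rw [const_ZH] at hi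
  obtain ⟨-, e2, e3⟩ := (hV.intertwines_iff htri _ _ _ _).1 hi
  have hd := dlog_diagonal (bs := bs) hy i
  have hs0 : y i * ∏ k, y k ^ (-bs.A i k) ≠ 0 :=
    mul_ne_zero (hy i) (Finset.prod_ne_zero_iff.2 fun k _ => zpow_ne_zero _ (hy k))
  obtain ⟨κ, hκ, rfl⟩ := exists_eq_C_mul_of_dlog_eq htri.s_ne hs0 (by
    rw [hd, div_eq_iff htri.s_ne]
    rw [cartanCoeff_sub_sum, sum_A_mul_C] at e2
    linear_combination e2)
  have hκ' : ofPoly (C κ) ≠ 0 := ofPoly_ne_zero (by simpa using hκ)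
  rw [sum_A_mul_C, mul_zero, add_zero] at e3
  have e4 := (off_diagonal_iff (bs := bs) (ζ := ζ) (φ := φ) hy i (κ := ofPoly (C κ)) (f := -c)).1
    (by simpa [cartanCoeff] using e3)
  refine ⟨ofPoly (C κ⁻¹) * -c, ?_⟩
  have hinv : ofPoly (C κ⁻¹) * ofPoly (C κ) = 1 := by
    rw [← map_mul, ← C_mul, inv_mul_cancel₀ hκ, C_1, map_one]
  rw [dz_mul, dz_C]
  linear_combination ofPoly (C κ⁻¹) * e4 +
    φ i * (∏ k ∈ Finset.univ.erase i, y k ^ (-cartan bs k i)) * hinv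

/-- Two isomorphic standard opers have the same Cartan connection. The isomorphism lies in
`B₊(z) ∩ B₋(z)`, so it is diagonal on the planes, with equal diagonal entries as the `φ_i` agree;
since the Cartan matrix is nondegenerate, its entries are constant. -/
theorem IsFundamental.eq_of_standardOper_equiv [∀ i, FiniteDimensional ℂ (V i)]
    (hV : IsFundamental bs V ν) {g g' φ : ι → RatFn} {hφ : ∀ i, φ i ≠ 0}
    (h : (MiuraOper.setoid bs V).r (standardOper bs V g φ hφ) (standardOper bs V g' φ hφ)) :
    g = g' := by
  obtain ⟨x, -, hx, hm, hp⟩ := h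
  simp only [standardOper, mul_one, inv_mem_iff] at hx hm hp
  choose t s c htri using hV.BPlus_le_triangular hp
  have hc : ∀ i, c i = 0 := fun i =>
    hV.off_diagonal_eq_zero (hV.BMinus_le_lowerStabilizer hm) (htri i)
  have key := fun i => (hV.intertwines_iff (htri i) g φ g' φ).1 fun w _ => (hx i w).symm
  have hst : ∀ i, s i = t i := by
    intro i
    have h3 := (key i).2.2
    rw [hc i, map_zero, zero_mul, zero_mul, zero_add, zero_add, zero_add] at h3
    exact mul_right_cancel₀ (hφ i) h3
  -- The first two equations differ by this combination, as the two diagonal entries agree.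
  have hsum : ∀ i, ∑ k, (bs.A i k : RatFn) * (g' k - g k) = 0 := by
    intro i
    obtain ⟨h1, h2, -⟩ := key i
    rw [hst i] at h2
    simp only [mul_sub, Finset.sum_sub_distrib]
    apply mul_left_cancel₀ (htri i).t_ne
    linear_combination h1 - h2
  have hdet : (bs.A.map (Int.castRingHom RatFn)).det ≠ 0 := by
    have := bs.nondegen.det_ne_zero
    rw [← RingHom.mapMatrix_apply, ← RingHom.map_det]
    simpa using this
  have h0 := Matrix.eq_zero_of_mulVec_eq_zero hdet (v := fun k => g' k - g k)
    (funext fun i => by simpa [Matrix.mulVec, dotProduct] using hsum i)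
  funext k
  exact (sub_eq_zero.1 (congrFun h0 k)).symm

theorem sl2Nondegenerate_of_poly {z : ℂ} {p ρ : ℂ[X]} (hp : p ≠ 0)
    (hs : ∀ w, p.rootMultiplicity w ≤ 1) (hρ : ∀ w, ρ.IsRoot w → ¬ p.IsRoot w) :
    SL2Nondegenerate z (ofPoly ρ) (ofPoly (C z) - dz (ofPoly p) / ofPoly p) := by
  refine ⟨⟨ρ, rfl⟩, ofPoly p, rfl, ?_, p, rfl⟩
  exact (yNondegenerate_ofPoly_iff (fun _ _ : Unit => (2 : ℤ)) (fun _ => ρ) fun _ => p).2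
    ⟨fun _ => hp, fun _ => hs, fun _ => hρ, fun i j _ hij => absurd (Subsingleton.elim i j) hij⟩

variable (V) in
/-- The Miura oper attached to a solution of the `qq`-system. -/
def NondegQQSolution.miuraOper (hL : ∀ i, L i ≠ 0) (q : NondegQQSolution bs ζ L) :
    MiuraOper bs V :=
  standardOper bs V (cartanCoeff ζ fun i => ofPoly (q.qPlus i)) (fun i => ofPoly (L i))
    fun i => ofPoly_ne_zero (hL i)

/-- The class of the Miura oper attached to a solution of the `qq`-system. -/
def NondegQQSolution.toOper [FiniteDimensional ℂ 𝔤] [∀ i, FiniteDimensional ℂ (V i)]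
    (hV : IsFundamental bs V ν) (hL : ∀ i, L i ≠ 0) (q : NondegQQSolution bs ζ L) :
    NondegMPOper bs ν ζ L :=
  ⟨Quotient.mk _ (q.miuraOper V hL), q.miuraOper V hL, rfl, by
      refine ⟨1, one_mem _, _, sum_h_mem_bMinus (cartanCoeff ζ fun i => ofPoly (q.qPlus i)), ?_⟩
      simp only [NondegQQSolution.miuraOper, standardOper, mul_one, inv_one]
      rw [add_comm]
      exact IsGauge.one _, by
      refine hV.isTwistedMiuraPlucker_standardOper (f := fun i => ofPoly (q.qMinus i))
        (fun i => ofPoly_ne_zero (q.monic i).ne_zero) _ fun i => ?_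
      rw [← q.eqn i, dz_ofPoly, dz_ofPoly]
      simp only [ofPoly, map_add, map_sub, map_mul], by
      obtain ⟨h1, h2, h3, h4⟩ := (yNondegenerate_ofPoly_iff _ _ _).1 q.nondeg
      refine ⟨cartanCoeff ζ fun i => ofPoly (q.qPlus i), fun i => ofPoly (q.qPlus i), ?_,
        fun i => rfl, q.nondeg, fun i => ?_⟩
      · refine ⟨1, one_mem _, ?_, ?_, ?_⟩
        · simp [NondegQQSolution.miuraOper, standardOper, one_mem]
        · simp [NondegQQSolution.miuraOper, standardOper, one_mem]
        · rw [inv_one]; exact IsGauge.one _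
      · rw [← ofPoly_rhsPoly]
        refine sl2Nondegenerate_of_poly (h1 i) (h2 i) fun w hw hr => ?_
        exact eval_rhsPoly_ne_zero (fun h => h3 i w h hr) (fun j hj ha h => h4 j i w hj ha h hr)
          hw⟩

theorem NondegQQSolution.toOper_eq_iff [FiniteDimensional ℂ 𝔤] [∀ i, FiniteDimensional ℂ (V i)]
    (hV : IsFundamental bs V ν) (hL : ∀ i, L i ≠ 0) (q q' : NondegQQSolution bs ζ L) :
    q.toOper hV hL = q'.toOper hV hL ↔ q.qPlus = q'.qPlus := by
  constructor
  · intro h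
    have h' := Quotient.exact (congrArg Subtype.val h)
    have hg := hV.eq_of_standardOper_equiv h'
    funext i
    have hi := congrFun hg i
    have hd : dz (ofPoly (q.qPlus i)) / ofPoly (q.qPlus i) =
        dz (ofPoly (q'.qPlus i)) / ofPoly (q'.qPlus i) := by
      simpa [cartanCoeff] using hi
    obtain ⟨c, hc, hcc⟩ := exists_eq_C_mul_of_dlog_eq (ofPoly_ne_zero (q.monic i).ne_zero)
      (ofPoly_ne_zero (q'.monic i).ne_zero) hd
    rw [← map_mul] at hcc
    have hpoly := ofPoly_injective hcc
    have hl := congrArg leadingCoeff hpoly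
    rw [(q.monic i).leadingCoeff, leadingCoeff_mul, (q'.monic i).leadingCoeff, leadingCoeff_C,
      mul_one] at hl
    rw [hpoly, ← hl, C_1, one_mul]
  · intro h
    apply Subtype.ext
    simp only [NondegQQSolution.toOper, NondegQQSolution.miuraOper, h]

theorem NondegQQSolution.isOperOf_toOper [FiniteDimensional ℂ 𝔤] [∀ i, FiniteDimensional ℂ (V i)]
    (hV : IsFundamental bs V ν) (hL : ∀ i, L i ≠ 0) (q : NondegQQSolution bs ζ L) :
    IsOperOf bs q (q.toOper hV hL) :=
  ⟨q.miuraOper V hL, rfl, rfl, rfl, rfl⟩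

theorem NondegQQSolution.toOper_surjective [FiniteDimensional ℂ 𝔤]
    [∀ i, FiniteDimensional ℂ (V i)] (hV : IsFundamental bs V ν) (hL : ∀ i, L i ≠ 0) :
    Function.Surjective (NondegQQSolution.toOper (ζ := ζ) hV hL) := by
  rintro ⟨_, M, rfl, -, ⟨A, -, hA, v, hv, hvA⟩, g, y, ⟨x, hx, hxm, hxp, hxg⟩, hg, hy, hsl⟩
  -- The functions `y i` are, up to constants, polynomials `q i`.
  have hq : ∀ i, ∃ q : ℂ[X], q.Monic ∧ ∃ c : ℂ, c ≠ 0 ∧ y i = ofPoly (C c) * ofPoly q := by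
    intro i
    obtain ⟨-, y', hy', hyn, p, rfl⟩ := hsl i
    have hp0 : ofPoly p ≠ 0 := hyn.ne_zero ()
    have hp : p ≠ 0 := by rintro rfl; simp at hp0
    have hlog : dz (y i) / y i = dz (ofPoly p) / ofPoly p := by
      rw [hg i] at hy'
      simpa using hy'
    obtain ⟨c, hc, hcp⟩ := exists_eq_C_mul_of_dlog_eq (hy.ne_zero i) hp0 hlog
    have hlc : p.leadingCoeff ≠ 0 := leadingCoeff_ne_zero.2 hp
    refine ⟨C p.leadingCoeff⁻¹ * p, ?_, c * p.leadingCoeff, mul_ne_zero hc hlc, ?_⟩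
    · rw [Monic, leadingCoeff_mul, leadingCoeff_C, inv_mul_cancel₀ hlc]
    · rw [hcp, ← map_mul, ← map_mul]
      congr 1
      rw [C_mul, mul_assoc, ← mul_assoc (C p.leadingCoeff), ← C_mul, mul_inv_cancel₀ hlc, C_1,
        one_mul]
  choose q hqm c hc hyq using hq
  have hq0 : ∀ i, q i ≠ 0 := fun i => (hqm i).ne_zero
  have hgq : g = cartanCoeff ζ fun i => ofPoly (q i) := by
    funext i
    rw [hg i, hyq i, dlog_C_mul (hc i), cartanCoeff]
  have hcop : ∀ i, y i = ofPoly (C (c i) * q i) := fun i => by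
    rw [hyq i, ← map_mul]
  have hnd : YNondegenerate (cartan bs) (fun i => ofPoly (L i)) fun i => ofPoly (q i) := by
    rw [show y = fun i => ofPoly (C (c i) * q i) from funext hcop, yNondegenerate_ofPoly_iff] at hy
    obtain ⟨-, h2, h3, h4⟩ := hy
    have hr : ∀ i w, (C (c i) * q i).IsRoot w ↔ (q i).IsRoot w := fun i w => by
      simp [IsRoot.def, hc i]
    simp only [hr] at h3 h4
    refine (yNondegenerate_ofPoly_iff _ _ _).2 ⟨hq0, fun i w => ?_, h3, h4⟩
    have := h2 i w
    rwa [rootMultiplicity_mul (mul_ne_zero (by simpa using hc i) (hq0 i)), rootMultiplicity_C,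
      zero_add] at this
  obtain ⟨-, hq2, -, -⟩ := (yNondegenerate_ofPoly_iff _ _ _).1 hnd
  -- In the trivialization given by `x`, the connections on the planes are intertwined with
  -- `∂_z + Z^H` by `b⁻¹ v`, where `b` is the change of trivialization of the `B₊`-reduction.
  set b := M.redPlus⁻¹ * x with hb
  have hbA : IsGauge b⁻¹ A (miuraMatrix bs g fun i => ofPoly (L i)) := by
    have h1 := hA.inv.mul hxg
    have : x⁻¹ * M.redPlus⁻¹⁻¹ = b⁻¹ := by rw [hb]; group
    rwa [this] at h1
  have hbt : b⁻¹ ∈ triangular bs ν := inv_mem (hV.BPlus_le_triangular hxp)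
  have hvt : v ∈ triangular bs ν := hV.BPlus_le_triangular hv
  have hplane : ∀ i, ∀ w ∈ MiuraOper.plane bs ν i,
      nabla V (miuraMatrix bs (cartanCoeff ζ fun i => ofPoly (q i)) fun i => ofPoly (L i)) i
          (act V (b⁻¹ * v) i w) =
        act V (b⁻¹ * v) i (nabla V (const (ZH bs ζ)) i w) := by
    intro i w hw'
    have h1 := hvA i (act V v i w) (act_mem_plane hvt hw')
    change _ = act V v i (nabla V (const (ZH bs ζ)) i (act V v⁻¹ i (act V v i w))) at h1
    rw [act_inv_act] at h1
    rw [act_mul, act_mul, ← h1, ← hgq]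
    exact (hbA i _).symm
  have hsol : ∀ i, ∃ f : ℂ[X], q i * derivative f - f * derivative (q i) +
      C (rootZH bs ζ i) * q i * f = rhsPoly bs L q i := by
    intro i
    obtain ⟨f, hf⟩ := hV.exists_rational_solution (fun i => ofPoly_ne_zero (hq0 i))
      (mul_mem hbt hvt) hplane i
    rw [← ofPoly_rhsPoly, dz_ofPoly] at hf
    obtain ⟨p, rfl⟩ := exists_ofPoly_of_wronskian_eq (hq0 i) (hq2 i) hf
    refine ⟨p, ofPoly_injective ?_⟩
    rw [← hf, dz_ofPoly]
    simp only [ofPoly, map_add, map_sub, map_mul]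
  choose f hf using hsol
  refine ⟨⟨q, f, fun i => by rw [hf i, ofPoly_rhsPoly], hqm, hnd⟩, Subtype.ext ?_⟩
  refine (Quotient.sound ?_).symm
  refine ⟨x⁻¹, inv_mem hx, ?_, ?_, ?_⟩
  · rw [hgq] at hxg
    exact hxg
  · simpa [NondegQQSolution.miuraOper, standardOper] using hxm
  · simpa [NondegQQSolution.miuraOper, standardOper] using hxp

end Solutions

end MiuraPlucker

end

theorem theorem5p10
    {ι : Type*} [Fintype ι] [DecidableEq ι]
    {𝔤 : Type*} [LieRing 𝔤] [LieAlgebra ℂ 𝔤] [FiniteDimensional ℂ 𝔤] [LieAlgebra.IsSimple ℂ 𝔤]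
    {H : LieSubalgebra ℂ 𝔤} (bs : LieAlgebra.Basis ι H)
    (V : ι → Type*) [∀ i, AddCommGroup (V i)] [∀ i, Module ℂ (V i)]
    [∀ i, FiniteDimensional ℂ (V i)]
    [∀ i, LieRingModule 𝔤 (V i)] [∀ i, LieModule ℂ 𝔤 (V i)]
    (ν : ∀ i, V i) (hV : MiuraPlucker.IsFundamental bs V ν)
    (ζ : ι → ℂ) (L : ι → Polynomial ℂ) (hL : ∀ i, (L i).Monic) :
    ∃ (F : MiuraPlucker.NondegQQSolution bs ζ L → MiuraPlucker.NondegMPOper bs ν ζ L)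
      (B : MiuraPlucker.NondegQQSolution bs ζ L → MiuraPlucker.BetheSolution bs ζ L),
      (∀ q, MiuraPlucker.IsOperOf bs q (F q)) ∧
      (∀ q i, (B q).roots i = (q.qPlus i).roots.toFinset) ∧
      Function.Surjective F ∧
      Function.Surjective B ∧
      (∀ q q', F q = F q' ↔ q.qPlus = q'.qPlus) ∧
      (∀ q q', B q = B q' ↔ q.qPlus = q'.qPlus) ∧
      ∃! Φ : MiuraPlucker.NondegMPOper bs ν ζ L ≃ MiuraPlucker.BetheSolution bs ζ L,
        ∀ q, Φ (F q) = B q := by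
  have hL0 : ∀ i, L i ≠ 0 := fun i => (hL i).ne_zero
  have hF := MiuraPlucker.NondegQQSolution.toOper_surjective (ζ := ζ) hV hL0
  have hB := MiuraPlucker.NondegQQSolution.toBethe_surjective (bs := bs) (ζ := ζ) (L := L)
  have hFeq := MiuraPlucker.NondegQQSolution.toOper_eq_iff (ζ := ζ) hV hL0
  have hBeq := MiuraPlucker.NondegQQSolution.toBethe_eq_iff (bs := bs) (ζ := ζ) (L := L)
  refine ⟨_, _, MiuraPlucker.NondegQQSolution.isOperOf_toOper hV hL0, fun q i => rfl, hF, hB, hFeq,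
    hBeq, ?_⟩
  have hcomp : ∀ q : MiuraPlucker.NondegQQSolution bs ζ L,
      (Function.surjInv hF (q.toOper hV hL0)).toBethe = q.toBethe := fun q =>
    (hBeq _ _).2 ((hFeq _ _).1 (Function.surjInv_eq hF _))
  refine ⟨Equiv.ofBijective (fun o => (Function.surjInv hF o).toBethe) ⟨?_, ?_⟩, hcomp, ?_⟩
  · intro o o' h
    have := (hFeq _ _).2 ((hBeq _ _).1 h)
    rwa [Function.surjInv_eq hF, Function.surjInv_eq hF] at this
  · intro β
    obtain ⟨q, rfl⟩ := hB β
    exact ⟨_, hcomp q⟩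
  · intro Ψ hΨ
    ext1 o
    obtain ⟨q, rfl⟩ := hF o
    rw [hΨ]
    exact (hcomp q).symm
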